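/- Let $X$ be a non-empty simplicial graph. Subgraphs are induced and are identified with their vertex sets; $lk(Y)$ is the set of vertices adjacent to every vertex of $Y$. A *graph factor system* $\mathfrak F$ on $X$ of complexity $n$ is a collection of non-empty induced subgraphs (*domains*) such that $X\in\mathfrak F$; $lk(v)\in\mathfrak F$ for every vertex $v$ with $lk(v)\neq\emptyset$; $F_1\cap F_2\in\mathfrak F$ whenever $F_1,F_2\in\mathfrak F$ and $F_1\cap F_2\ne\emptyset$; and every chain $F_1\subsetneq\dots\subsetneq F_k$ in $\mathfrak F$ has $k<n$. For an induced subgraph $F$, an *$F$-graph* is a graph whose vertices are the maximal cliques of $F$. Write $F^\perp=lk(F)$. Given an $X$-graph $W$, let $B=\{b_F : F\in\mathfrak F\setminus\{X\}\}$ be a set of new vertices. The *augmented graph* $CX$ has vertex set $V(X)\cup B$; two distinct vertices $v,w$ of $X$ are adjacent if they are adjacent in $X$ or lie in two $W$-adjacent maximal cliques respectively; $v\in V(X)$ and $b_F$ are adjacent if $v\in F$; there are no other edges. For $F\in\mathfrak F$, $CF$ is the subgraph of $CX$ induced on $V(F)\cup\{b_H : H\in\mathfrak F,\ H\subsetneq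 F\}$, and the *complement graph* $Y_F$ is the subgraph of $CX$ induced on $(V(X)\cup B)\setminus PF$, where $$PF=F^\perp\cup\{b_H\in B : H\subseteq F^\perp\}\cup\{b_H\in B : F\subseteq H\}.$$ For an $F$-graph $W^F$ and a domain $F'\subseteq F$, let $C_FF'$ denote the graph $CF'$ formed with $(F,W^F,\{H\in\mathfrak F: H\subseteq F\})$ in place of $(X,W,\mathfrak F)$. The triple $(X,W,\mathfrak F)$ is a *combinatorial HHS with factor system* (CHHF) with constants $n\in\mathbb N$ and $\delta>0$ if $\mathfrak F$ is a graph factor system of complexity $n$ and 1. (hyperbolicity) for every $F\in\mathfrak F$ the graph $CF$ is $\delta$-hyperbolic, and the inclusion $CF\hookrightarrow Y_F$ is a $(\delta,\delta)$-quasi-isometric embedding; 2. (hierarchy) there are $F$-graphs $W^F$, $F\in\mathfrak F$, such that for all domains $F'\subseteq F$ we have $C_FF'=CF'$, and for every (possibly empty) maximal clique $x$ of $F'^\perp\cap F$ there is a graph morphism $W^{F'}\to W^F$ sending each maximal clique $w$ of $F'$ to a maximal clique of $F$ that contains $x\ast w$. Here a graph is called $\delta$-hyperbolic if it is connected and each side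 of each geodesic triangle with vertices at vertices of the graph lies, at the level of vertices, in the $\delta$-neighbourhood of the union of the other two sides. **Lemma 3.10.** For every $n\in\mathbb N$ and $\delta>0$ there is $\delta'=\delta'(n,\delta)>0$ such that for every CHHF $(X,W,\mathfrak F)$ with constants $n$ and $\delta$ and for every domain $F\in\mathfrak F$, the complement graph $Y_F$ is $\delta'$-hyperbolic. -/

import Mathlib

universe u

/-- A graph is `δ`-hyperbolic if it is connected and its geodesic triangles are `δ`-slim. -/
def IsHyperbolicGraph {α : Type*} (δ : ℝ) (G : SimpleGraph α) : Prop :=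
  G.Connected ∧
    ∀ (x y z : α) (p : G.Walk x y) (q : G.Walk y z) (r : G.Walk x z),
      p.length = G.dist x y → q.length = G.dist y z → r.length = G.dist x z →
        ∀ a ∈ p.support, ∃ b, (b ∈ q.support ∨ b ∈ r.support) ∧ (G.dist a b : ℝ) ≤ δ

/-- A `(K, C)`-quasi-isometric embedding of a connected graph `G` into a graph `H`
(on vertices, for the path metrics). Reachability is required because `SimpleGraph.dist` has the
value `0` on pairs of vertices in distinct components. -/
def IsQIEmbedding {α β : Type*} (K C : ℝ) (G : SimpleGraph α) (H : SimpleGraph β)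
    (f : α → β) : Prop :=
  ∀ x y : α, H.Reachable (f x) (f y) ∧
    (G.dist x y : ℝ) / K - C ≤ (H.dist (f x) (f y) : ℝ) ∧
    (H.dist (f x) (f y) : ℝ) ≤ K * (G.dist x y : ℝ) + C

namespace CHHF

variable {V : Type u}

/-- The link of a set of vertices: the vertices adjacent to all of its members. Induced subgraphs
of `X` are represented by their vertex sets throughout. -/
def link (X : SimpleGraph V) (S : Set V) : Set V := {v | ∀ w ∈ S, X.Adj v w}

/-- The maximal cliques of the subgraph of `X` induced by `S`. -/
abbrev MaxClique (X : SimpleGraph V) (S : Set V) : Type u :=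
  {c : Set V // Maximal (fun s : Set V => s ⊆ S ∧ X.IsClique s) c}

/-- `𝔉` is a graph factor system on `X` of complexity (at most) `n`; domains are non-empty. -/
structure IsGraphFactorSystem (X : SimpleGraph V) (𝔉 : Set (Set V)) (n : ℕ) : Prop where
  nonempty : ∀ F ∈ 𝔉, F.Nonempty
  univ_mem : Set.univ ∈ 𝔉
  link_mem : ∀ v : V, (link X {v}).Nonempty → link X {v} ∈ 𝔉
  inter_mem : ∀ F₁ ∈ 𝔉, ∀ F₂ ∈ 𝔉, (F₁ ∩ F₂).Nonempty → F₁ ∩ F₂ ∈ 𝔉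
  chain_lt : ∀ (k : ℕ) (F : Fin k → Set V), StrictMono F → (∀ i, F i ∈ 𝔉) → k < n

/-- Ambient type for the vertices of augmented graphs: `Sum.inl v` is the vertex `v` of the
graph and `Sum.inr F` is the projection vertex `b_F`. -/
abbrev AugVertex (V : Type u) : Type u := V ⊕ Set V

/-- The three kinds of edges of the augmented graph: edges of `X`, additional edges between
vertices in `W`-adjacent maximal cliques, edges from `b_F` to the vertices of `F`. -/
def augRel (X : SimpleGraph V) {S : Set V} (W : SimpleGraph (MaxClique X S)) :
    AugVertex V → AugVertex V → Prop
  | Sum.inl v, Sum.inl w => X.Adj v w ∨ ∃ c d : MaxClique X S, W.Adj c d ∧ v ∈ c.1 ∧ w ∈ d.1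
  | Sum.inl v, Sum.inr F => v ∈ F
  | Sum.inr _, _ => False

/-- Adjacency in the augmented graph of the subgraph of `X` induced by `S`, where `W` is an
`S`-graph, on the ambient type; it is only used after restriction to a set of vertices of this
augmented graph. Symmetrized and without loops. -/
def augAdj (X : SimpleGraph V) {S : Set V} (W : SimpleGraph (MaxClique X S)) :
    SimpleGraph (AugVertex V) :=
  SimpleGraph.fromRel (augRel X W)

/-- The vertex set `V(F) ∪ B_F`, with `B_F` the projection vertices of domains properly
contained in `F`. -/
def augVerts (𝔉 : Set (Set V)) (F : Set V) : Set (AugVertex V) :=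
  Sum.inl '' F ∪ Sum.inr '' {H | H ∈ 𝔉 ∧ H ⊂ F}

/-- For a domain `F ⊆ S` and an `S`-graph `W`: the augmented graph `C_S F`, that is, the subgraph
induced on `V(F) ∪ B_F` in the augmented graph of `S`. For `S = univ` it is `CF`, and for
`S = F = univ` it is `CX`. -/
def augGraph (X : SimpleGraph V) {S : Set V} (W : SimpleGraph (MaxClique X S))
    (𝔉 : Set (Set V)) (F : Set V) : SimpleGraph (augVerts 𝔉 F) :=
  (augAdj X W).induce (augVerts 𝔉 F)

/-- The projection part `PF`: the vertices of `F^⊥ = lk(F)`, the projection vertices of the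
domains contained in `F^⊥` (including `F^⊥` itself when it is a domain), and the projection
vertices of the proper domains containing `F`. -/
def projPart (X : SimpleGraph V) (𝔉 : Set (Set V)) (F : Set V) : Set (AugVertex V) :=
  Sum.inl '' link X F ∪ Sum.inr '' {H | H ∈ 𝔉 ∧ H ⊂ Set.univ ∧ (H ⊆ link X F ∨ F ⊆ H)}

/-- The vertex set `(V(X) ∪ B) - PF` of the complement graph. -/
def complVerts (X : SimpleGraph V) (𝔉 : Set (Set V)) (F : Set V) : Set (AugVertex V) :=
  augVerts 𝔉 Set.univ \ projPart X 𝔉 F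

/-- The complement graph `Y_F`: the subgraph of `CX` induced on `(V(X) ∪ B) - PF`. -/
def complGraph (X : SimpleGraph V) (W : SimpleGraph (MaxClique X Set.univ))
    (𝔉 : Set (Set V)) (F : Set V) : SimpleGraph (complVerts X 𝔉 F) :=
  (augAdj X W).induce (complVerts X 𝔉 F)

/-- The vertices of `CF` always lie in `Y_F`. -/
theorem augVerts_subset_complVerts {X : SimpleGraph V} {𝔉 : Set (Set V)} {n : ℕ}
    (h : IsGraphFactorSystem X 𝔉 n) (F : Set V) :
    augVerts 𝔉 F ⊆ complVerts X 𝔉 F := by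
  rintro _ (⟨v, hv, rfl⟩ | ⟨H, ⟨hH, hHF⟩, rfl⟩)
  · refine ⟨Or.inl ⟨v, Set.mem_univ v, rfl⟩, ?_⟩
    rintro (⟨w, hw, hwv⟩ | ⟨K, _, hK⟩)
    · obtain rfl := Sum.inl.inj hwv
      exact (hw w hv).ne rfl
    · cases hK
  · refine ⟨Or.inr ⟨H, ⟨hH, hHF.trans_subset (Set.subset_univ F)⟩, rfl⟩, ?_⟩
    rintro (⟨w, _, hw⟩ | ⟨K, ⟨_, _, hK⟩, hKH⟩)
    · cases hw
    · obtain rfl := Sum.inr.inj hKH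
      rcases hK with hK | hK
      · obtain ⟨v, hv⟩ := h.nonempty K hH
        exact (hK hv v (hHF.1 hv)).ne rfl
      · exact hHF.2 hK

/-- The `δ`-hyperbolicity condition: every `CF` is `δ`-hyperbolic, and the inclusion of `CF`
in `Y_F` is a `(δ, δ)`-quasi-isometric embedding. -/
def HyperbolicityCondition (X : SimpleGraph V) (W : SimpleGraph (MaxClique X Set.univ))
    (𝔉 : Set (Set V)) (δ : ℝ) : Prop :=
  ∀ F ∈ 𝔉, IsHyperbolicGraph δ (augGraph X W 𝔉 F) ∧
    ∃ h : augVerts 𝔉 F ⊆ complVerts X 𝔉 F,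
      IsQIEmbedding δ δ (augGraph X W 𝔉 F) (complGraph X W 𝔉 F) (Set.inclusion h)

/-- The hierarchy condition: there are `F`-graphs `W^F` (`F ∈ 𝔉`) such that `C_F F' = CF'` for
all domains `F' ⊆ F`, and every maximal clique `x` of `F'^⊥ ∩ F` (possibly empty) admits a graph
morphism `W^{F'} → W^F` taking `w` to a maximal clique of `F` that contains the join `x ∗ w`. -/
def HierarchyCondition (X : SimpleGraph V) (W : SimpleGraph (MaxClique X Set.univ))
    (𝔉 : Set (Set V)) : Prop :=
  ∃ WF : ∀ F : Set V, SimpleGraph (MaxClique X F),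
    ∀ F ∈ 𝔉, ∀ F' ∈ 𝔉, F' ⊆ F →
      augGraph X (WF F) 𝔉 F' = augGraph X W 𝔉 F' ∧
      ∀ x : MaxClique X (link X F' ∩ F),
        ∃ φ : WF F' →g WF F, ∀ w : MaxClique X F', x.1 ∪ w.1 ⊆ (φ w).1

/-- `(X, W, 𝔉)` is a combinatorial HHS with factor system, with complexity `n` and
hyperbolicity constant `δ`. -/
structure IsCHHF (X : SimpleGraph V) (W : SimpleGraph (MaxClique X Set.univ))
    (𝔉 : Set (Set V)) (n : ℕ) (δ : ℝ) : Prop where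
  factorSystem : IsGraphFactorSystem X 𝔉 n
  hyperbolicity : HyperbolicityCondition X W 𝔉 δ
  hierarchy : HierarchyCondition X W 𝔉

end CHHF

/-!
A graph is hyperbolic as soon as its pairs of points are joined by connected sets that behave like
geodesics of a hyperbolic graph: small for adjacent points, with uniformly slim triangles. This
criterion is used twice.

First, the part of `CL` carried by `F^⊥` can be discarded when `F ⊆ L`: sending it to the
projection vertex `b_F` is a coarse retraction onto the rest, because `b_F` is close to every vertex
adjacent to the discarded part, through the projection vertices of the links of vertices of `F^⊥`.

The case `L = X` leaves `Y_F` together with the vertices `b_L`, `F ⊆ L ⊊ X`. These are removed in at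
most `n + 1` stages, beginning with the largest domains. When `b_L` is removed, its base, the
trimmed `CL`, is hyperbolic and is quasi-isometrically embedded in the complement of `b_L`, since by
now that complement lies in `Y_L`. Replacing the passages of geodesics through `b_L` by geodesics of
the base produces slim triangles, because a geodesic that misses `b_L` has ends with nearby
projections to the base.
-/

namespace HyperbolicGraph

open SimpleGraph

section GuessingGeodesics

variable {β : Type*} {H : SimpleGraph β} {g : ℕ → β} {l i j : ℕ}

/-- `g 0, …, g l` are the consecutive vertices of a geodesic of `H`. -/
def IsGeodesicSeq (H : SimpleGraph β) (g : ℕ → β) (l : ℕ) : Prop :=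
  ∀ ⦃i j : ℕ⦄, i ≤ j → j ≤ l → H.dist (g i) (g j) = j - i

theorem dist_getVert_le {x y : β} (p : H.Walk x y) (hij : i ≤ j) :
    H.dist (p.getVert i) (p.getVert j) ≤ j - i := by
  have h := H.dist_le ((p.drop i).take (j - i))
  rw [Walk.take_length, Walk.drop_getVert, Nat.add_sub_cancel' hij] at h
  omega

theorem isGeodesicSeq_getVert (hH : H.Connected) {x y : β} {p : H.Walk x y}
    (hp : p.length = H.dist x y) : IsGeodesicSeq H p.getVert p.length := by
  intro i j hij hj
  have h₁ := dist_getVert_le p hij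
  have h₂ := dist_getVert_le p (Nat.zero_le i)
  have h₃ := dist_getVert_le p hj
  rw [Walk.getVert_zero] at h₂
  rw [Walk.getVert_length] at h₃
  have h₄ := hH.dist_triangle (u := x) (v := p.getVert i) (w := y)
  have h₅ := hH.dist_triangle (u := p.getVert i) (v := p.getVert j) (w := y)
  omega

theorem IsGeodesicSeq.le_add_dist (hg : IsGeodesicSeq H g l) (hH : H.Connected) (hj : j ≤ l)
    (v : β) : j ≤ i + (H.dist v (g i) + H.dist v (g j)) := by
  rcases le_total i j with hij | hji
  · have h := hH.dist_triangle (u := g i) (v := v) (w := g j)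
    rw [hg hij hj, H.dist_comm] at h
    omega
  · omega

/-- A family of sets `L x y`, each containing a walk from `x` to `y`, that is `h`-small for nearby
points and has `h`-slim triangles. -/
structure IsSlimFamily (H : SimpleGraph β) (L : β → β → Set β) (h : ℕ) : Prop where
  walk : ∀ x y, ∃ p : H.Walk x y, ∀ v ∈ p.support, v ∈ L x y
  small : ∀ x y, H.dist x y ≤ 1 → ∀ v ∈ L x y, H.dist v x ≤ h
  slim : ∀ x y z, ∀ v ∈ L x y, ∃ w, (w ∈ L x z ∨ w ∈ L z y) ∧ H.dist v w ≤ h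

theorem exists_forall_mul_le_two_pow (C : ℕ) : ∃ m₀, ∀ m, m₀ ≤ m → C * (m + 4) ≤ 2 ^ m := by
  refine ⟨C + (C + 4), fun m hm => ?_⟩
  induction m, hm using Nat.le_induction with
  | base =>
    have hC := Nat.lt_two_pow_self (n := C)
    rw [pow_add, pow_add]
    nlinarith
  | succ m hm ih =>
    rw [pow_succ]
    nlinarith

/-- Here `m` is an upper bound for the binary logarithm of `6 * r`. -/
theorem exists_log_bound (h : ℕ) :
    ∃ R, 3 * h ≤ R ∧ ∀ r, R < r → ∃ m, 6 * r ≤ 2 ^ m ∧ h * m + 3 * h < r := by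
  obtain ⟨m₀, hm₀⟩ := exists_forall_mul_le_two_pow (6 * (h + 1))
  refine ⟨(h + 1) * (m₀ + 3), by nlinarith, fun r hr => ?_⟩
  obtain ⟨k, hk⟩ : ∃ k, (r - 1) / (h + 1) = m₀ + 3 + k :=
    Nat.exists_eq_add_of_le ((Nat.le_div_iff_mul_le h.succ_pos).2
      (by rw [mul_comm]; exact Nat.le_sub_one_of_lt hr))
  have hlt := Nat.lt_mul_div_succ (r - 1) h.succ_pos
  have hle := Nat.mul_div_le (r - 1) (h + 1)
  rw [Nat.succ_eq_add_one] at hlt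
  rw [hk] at hlt hle
  have hpow := hm₀ (m₀ + k) (Nat.le_add_right _ _)
  refine ⟨m₀ + k, ?_, ?_⟩
  · nlinarith [(by omega : r ≤ r - 1 + 1)]
  · nlinarith [(by omega : r - 1 < r)]

namespace IsSlimFamily

variable {L : β → β → Set β} {h R : ℕ}

theorem connected [Nonempty β] (hL : IsSlimFamily H L h) : H.Connected :=
  ⟨fun x y => ⟨(hL.walk x y).choose⟩⟩

theorem slim_quadrilateral (hL : IsSlimFamily H L h) (hH : H.Connected) (x y a b : β) {v : β}
    (hv : v ∈ L x y) :
    ∃ w, (w ∈ L x a ∨ w ∈ L a b ∨ w ∈ L b y) ∧ H.dist v w ≤ 2 * h := by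
  obtain ⟨u, hu | hu, hvu⟩ := hL.slim x y a v hv
  · exact ⟨u, Or.inl hu, by omega⟩
  · obtain ⟨w, hw, huw⟩ := hL.slim a y b u hu
    have := hH.dist_triangle (u := v) (v := u) (w := w)
    exact ⟨w, Or.inr hw, by omega⟩

theorem near_chain (hL : IsSlimFamily H L h) (hH : H.Connected)
    (hg : ∀ t, t < l → H.dist (g t) (g (t + 1)) ≤ 1) (m : ℕ) :
    ∀ {i j : ℕ}, i ≤ j → j ≤ l → j ≤ i + 2 ^ m → ∀ v ∈ L (g i) (g j),
      ∃ t, i ≤ t ∧ t ≤ j ∧ H.dist v (g t) ≤ h * m + h := by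
  induction m with
  | zero =>
    intro i j hij hj hm v hv
    refine ⟨i, le_rfl, hij, ?_⟩
    have hdist : H.dist (g i) (g j) ≤ 1 := by
      obtain rfl | rfl : j = i ∨ j = i + 1 := by omega
      · simp
      · exact hg i hj
    simpa using hL.small _ _ hdist v hv
  | succ m ih =>
    intro i j hij hj hm v hv
    rw [pow_succ] at hm
    obtain ⟨c, hic, hcj, hci, hjc⟩ : ∃ c, i ≤ c ∧ c ≤ j ∧ c ≤ i + 2 ^ m ∧ j ≤ c + 2 ^ m :=
      ⟨min j (i + 2 ^ m), by omega, by omega, by omega, by omega⟩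
    obtain ⟨w, hw, hvw⟩ := hL.slim _ _ (g c) v hv
    obtain ⟨t, hit, htj, ht⟩ : ∃ t, i ≤ t ∧ t ≤ j ∧ H.dist w (g t) ≤ h * m + h := by
      rcases hw with hw | hw
      · obtain ⟨t, hit, htc, ht⟩ := ih hic (hcj.trans hj) hci w hw
        exact ⟨t, hit, htc.trans hcj, ht⟩
      · obtain ⟨t, hct, htj, ht⟩ := ih hcj hj hjc w hw
        exact ⟨t, hic.trans hct, htj, ht⟩
    have := hH.dist_triangle (u := v) (v := w) (w := g t)
    exact ⟨t, hit, htj, by rw [Nat.mul_succ]; omega⟩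

/-- If `v` is at distance `r > R` from the geodesic, compare `L (g i) (g j)` with the subfamily over
the subsegment of radius `3 * r` about the point `g c` closest to `v`: by `near_chain` the middle
part comes too close to the geodesic, and by induction the outer parts are too far from `g c`. -/
theorem near_geodesicSeq (hL : IsSlimFamily H L h) (hH : H.Connected) (hR : 3 * h ≤ R)
    (hlog : ∀ r, R < r → ∃ m, 6 * r ≤ 2 ^ m ∧ h * m + 3 * h < r) (hg : IsGeodesicSeq H g l)
    (hij : i ≤ j) (hj : j ≤ l) {v : β} (hv : v ∈ L (g i) (g j)) :
    ∃ t, i ≤ t ∧ t ≤ j ∧ H.dist v (g t) ≤ R := by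
  induction hn : j - i using Nat.strong_induction_on generalizing i j v with
  | _ n ih =>
  by_contra! hfar
  obtain ⟨c, hc, hmin⟩ := (Finset.Icc i j).exists_min_image (fun t => H.dist v (g t))
    ⟨i, Finset.left_mem_Icc.2 hij⟩
  simp only [Finset.mem_Icc] at hc hmin
  set r := H.dist v (g c)
  have hr : R < r := hfar c hc.1 hc.2
  have htri : ∀ w t, H.dist v (g t) ≤ H.dist v w + H.dist w (g t) := fun w t => hH.dist_triangle
  have hpt : ∀ t, i ≤ t → t ≤ j → ∀ w ∈ L (g t) (g t), 2 * h < H.dist v w := by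
    intro t hit htj w hw
    have := hL.small _ _ (by simp) w hw
    have := hfar t hit htj
    have := htri w t
    omega
  obtain ⟨a, hia, hac, ha⟩ : ∃ a, i ≤ a ∧ a ≤ c ∧ (a = i ∧ c ≤ a + 3 * r ∨ c = a + 3 * r) :=
    ⟨max i (c - 3 * r), by omega⟩
  obtain ⟨b, hcb, hbj, hb⟩ : ∃ b, c ≤ b ∧ b ≤ j ∧ (b = j ∧ b ≤ c + 3 * r ∨ b = c + 3 * r) :=
    ⟨min j (c + 3 * r), by omega⟩
  obtain ⟨w, hw | hw | hw, hvw⟩ := hL.slim_quadrilateral hH _ _ (g a) (g b) hv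
  · rcases ha with ⟨rfl, -⟩ | ha
    · exact (hpt a le_rfl hij w hw).not_ge hvw
    · obtain ⟨t, -, hta, ht⟩ := ih (a - i) (by omega) hia (by omega) hw rfl
      have := hg.le_add_dist hH (i := t) (hc.2.trans hj) v
      have := htri w t
      omega
  · obtain ⟨m, hm, hmr⟩ := hlog r hr
    obtain ⟨t, hat, htb, ht⟩ := hL.near_chain hH (fun t ht => (hg t.le_succ ht).le.trans (by omega))
      m (hac.trans hcb) (hbj.trans hj) (by omega) w hw
    have := hmin t ⟨hia.trans hat, htb.trans hbj⟩
    have := htri w t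
    omega
  · rcases hb with ⟨rfl, -⟩ | hb
    · exact (hpt b hij le_rfl w hw).not_ge hvw
    · obtain ⟨t, hbt, htj, ht⟩ := ih (j - b) (by omega) hbj hj hw rfl
      have := hg.le_add_dist hH (i := c) (htj.trans hj) v
      have := htri w t
      omega

theorem geodesicSeq_near (hL : IsSlimFamily H L h) (hH : H.Connected) (hg : IsGeodesicSeq H g l)
    (hnear : ∀ v ∈ L (g 0) (g l), ∃ t ≤ l, H.dist v (g t) ≤ R) (hi : i ≤ l) :
    ∃ v ∈ L (g 0) (g l), H.dist v (g i) ≤ 3 * R + 1 := by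
  obtain ⟨p, hp⟩ := hL.walk (g 0) (g l)
  have hdist : ∀ u t, t ≤ i → H.dist u (g t) ≤ R → H.dist u (g i) ≤ R + (i - t) := by
    intro u t hti hut
    have := hH.dist_triangle (u := u) (v := g t) (w := g i)
    rw [hg hti hi] at this
    omega
  let Q : Set β := {u | ∃ t ≤ i, H.dist u (g t) ≤ R}
  by_cases hlQ : g l ∈ Q
  · obtain ⟨t, hti, ht⟩ := hlQ
    refine ⟨g l, hp _ p.end_mem_support, (hdist _ t hti ht).trans ?_⟩
    rw [H.dist_comm, hg (hti.trans hi) le_rfl] at ht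
    omega
  · obtain ⟨d, hd, ⟨t, hti, ht⟩, hsnd⟩ :=
      p.exists_boundary_dart Q ⟨0, Nat.zero_le _, by simp⟩ hlQ
    refine ⟨d.fst, hp _ (p.dart_fst_mem_support_of_mem_darts hd), (hdist _ t hti ht).trans ?_⟩
    obtain ⟨s, hsl, hs⟩ := hnear d.snd (hp _ (p.dart_snd_mem_support_of_mem_darts hd))
    have his : i < s := not_le.1 fun hsi => hsnd ⟨s, hsi, hs⟩
    have hgap := hg.le_add_dist hH (i := t) hsl d.fst
    have htri := hH.dist_triangle (u := d.fst) (v := d.snd) (w := g s)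
    rw [SimpleGraph.dist_eq_one_iff_adj.2 d.adj] at htri
    omega

end IsSlimFamily

/-- The *guessing geodesics* criterion. -/
theorem exists_isHyperbolicGraph_of_isSlimFamily (h : ℕ) :
    ∃ N : ℕ, ∀ (β : Type*) [Nonempty β] (H : SimpleGraph β) (L : β → β → Set β),
      IsSlimFamily H L h → IsHyperbolicGraph N H := by
  obtain ⟨R, hR, hlog⟩ := exists_log_bound h
  refine ⟨3 * R + 1 + h + R, fun β _ H L hL => ⟨hL.connected, ?_⟩⟩
  have hH := hL.connected
  have hnear : ∀ {x y : β} (k : H.Walk x y), k.length = H.dist x y → ∀ v ∈ L x y,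
      ∃ t ≤ k.length, H.dist v (k.getVert t) ≤ R := by
    intro x y k hk v hv
    obtain ⟨t, -, htl, ht⟩ := hL.near_geodesicSeq hH hR hlog (isGeodesicSeq_getVert hH hk)
      (Nat.zero_le _) le_rfl (by simpa using hv)
    exact ⟨t, htl, ht⟩
  intro x y z p q r hp hq hr a ha
  obtain ⟨i, rfl, hi⟩ := Walk.mem_support_iff_exists_getVert.1 ha
  obtain ⟨u, hu, hau⟩ := hL.geodesicSeq_near hH (isGeodesicSeq_getVert hH hp)
    (by simpa using hnear p hp) hi
  obtain ⟨w, hw, huw⟩ := hL.slim x y z u (by simpa using hu)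
  obtain ⟨b, hb, hwb⟩ : ∃ b, (b ∈ q.support ∨ b ∈ r.support) ∧ H.dist w b ≤ R := by
    rcases hw with hw | hw
    · obtain ⟨t, -, ht⟩ := hnear r hr w hw
      exact ⟨_, Or.inr (r.getVert_mem_support t), ht⟩
    · obtain ⟨t, -, ht⟩ := hnear q.reverse (by rw [Walk.length_reverse, hq, H.dist_comm]) w hw
      exact ⟨_, Or.inl (by simpa using q.reverse.getVert_mem_support t), ht⟩
  refine ⟨b, hb, ?_⟩
  have h₁ := hH.dist_triangle (u := p.getVert i) (v := u) (w := w)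
  have h₂ := hH.dist_triangle (u := p.getVert i) (v := w) (w := b)
  rw [H.dist_comm (u := p.getVert i) (v := u)] at h₁
  exact_mod_cast (by omega : H.dist (p.getVert i) b ≤ 3 * R + 1 + h + R)

end GuessingGeodesics

section InducedSubgraphs

variable {α : Type*} {G : SimpleGraph α} {S T : Set α} {x y z u v : α} {m n : ℕ}

/-- There is a walk of length at most `n` from `x` to `y` inside `S`. -/
def NearIn (G : SimpleGraph α) (S : Set α) (n : ℕ) (x y : α) : Prop :=
  ∃ p : G.Walk x y, p.length ≤ n ∧ ∀ v ∈ p.support, v ∈ S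

namespace NearIn

theorem refl (hx : x ∈ S) (n : ℕ) : NearIn G S n x x :=
  ⟨Walk.nil, Nat.zero_le _, by simpa using hx⟩

theorem left_mem (h : NearIn G S n x y) : x ∈ S := by
  obtain ⟨p, -, hp⟩ := h
  exact hp _ p.start_mem_support

theorem right_mem (h : NearIn G S n x y) : y ∈ S := by
  obtain ⟨p, -, hp⟩ := h
  exact hp _ p.end_mem_support

theorem symm (h : NearIn G S n x y) : NearIn G S n y x := by
  obtain ⟨p, hp, hS⟩ := h
  exact ⟨p.reverse, by simpa using hp, by simpa using hS⟩

theorem trans (h : NearIn G S m x y) (h' : NearIn G S n y z) : NearIn G S (m + n) x z := by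
  obtain ⟨p, hp, hS⟩ := h
  obtain ⟨q, hq, hS'⟩ := h'
  refine ⟨p.append q, by rw [Walk.length_append]; omega, fun v hv => ?_⟩
  rcases (Walk.mem_support_append_iff _ _).1 hv with hv | hv
  exacts [hS v hv, hS' v hv]

theorem le (h : NearIn G S m x y) (hmn : m ≤ n) : NearIn G S n x y := by
  obtain ⟨p, hp, hS⟩ := h
  exact ⟨p, hp.trans hmn, hS⟩

theorem mono (h : NearIn G S n x y) (hST : S ⊆ T) : NearIn G T n x y := by
  obtain ⟨p, hp, hS⟩ := h
  exact ⟨p, hp, fun v hv => hST (hS v hv)⟩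

theorem of_adj (h : G.Adj x y) (hx : x ∈ S) (hy : y ∈ S) : NearIn G S 1 x y :=
  ⟨h.toWalk, by simp, by simp [hx, hy]⟩

theorem inter_ball (h : NearIn G S n x y) : NearIn G (S ∩ {v | NearIn G S n v x}) n x y := by
  obtain ⟨p, hp, hS⟩ := h
  refine ⟨p, hp, fun v hv => ⟨hS v hv, ?_⟩⟩
  obtain ⟨q, r, rfl⟩ := Walk.mem_support_iff_exists_append.1 hv
  rw [Walk.length_append] at hp
  exact symm ⟨q, by omega, fun w hw => hS w ((Walk.mem_support_append_iff q r).2 (Or.inl hw))⟩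

end NearIn

theorem length_induce (p : G.Walk x y) (hp : ∀ v ∈ p.support, v ∈ S) :
    (p.induce S hp).length = p.length := by
  induction p with
  | nil => rfl
  | cons h p ih =>
    rw [Walk.induce_cons, Walk.length_cons, Walk.length_cons, ih]

theorem nearIn_iff_induce (hx : x ∈ S) (hy : y ∈ S) :
    NearIn G S n x y ↔ ∃ p : (G.induce S).Walk ⟨x, hx⟩ ⟨y, hy⟩, p.length ≤ n := by
  constructor
  · rintro ⟨p, hp, hS⟩
    exact ⟨p.induce S hS, (length_induce p hS).trans_le hp⟩
  · rintro ⟨p, hp⟩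
    let f : G.induce S →g G := (Embedding.induce S).toHom
    refine ⟨p.map f, (Walk.length_map f p).trans_le hp, fun v hv => ?_⟩
    have hv' : v ∈ p.support.map f := (Walk.support_map f p) ▸ hv
    rw [List.mem_map] at hv'
    obtain ⟨w, -, rfl⟩ := hv'
    exact w.2

/-- The path metric of the subgraph induced on `S`, with value `0` where there is no path. -/
noncomputable def distIn (G : SimpleGraph α) (S : Set α) (x y : α) : ℕ :=
  sInf {n | NearIn G S n x y}

/-- The subgraph induced on `S` is preconnected. -/
def ConnIn (G : SimpleGraph α) (S : Set α) : Prop :=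
  ∀ x ∈ S, ∀ y ∈ S, ∃ n, NearIn G S n x y

theorem NearIn.distIn_le (h : NearIn G S n x y) : distIn G S x y ≤ n := Nat.sInf_le h

theorem distIn_eq_dist (hx : x ∈ S) (hy : y ∈ S) :
    distIn G S x y = (G.induce S).dist ⟨x, hx⟩ ⟨y, hy⟩ := by
  by_cases h : (G.induce S).Reachable ⟨x, hx⟩ ⟨y, hy⟩
  · obtain ⟨p, hp⟩ := h.exists_walk_length_eq_dist
    apply le_antisymm
    · exact NearIn.distIn_le ((nearIn_iff_induce hx hy).2 ⟨p, hp.le⟩)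
    · have hne : {n | NearIn G S n x y}.Nonempty :=
        ⟨_, (nearIn_iff_induce hx hy).2 ⟨p, le_rfl⟩⟩
      obtain ⟨q, hq⟩ := (nearIn_iff_induce hx hy).1 (Nat.sInf_mem hne)
      exact ((G.induce S).dist_le q).trans hq
  · rw [dist_eq_zero_of_not_reachable h, distIn]
    suffices {n | NearIn G S n x y} = ∅ by rw [this]; exact Nat.sInf_empty
    refine Set.eq_empty_of_forall_notMem fun n hn => ?_
    obtain ⟨p, -⟩ := (nearIn_iff_induce hx hy).1 hn
    exact h ⟨p⟩

theorem connIn_of_connected (h : (G.induce S).Connected) : ConnIn G S := by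
  intro x hx y hy
  obtain ⟨p⟩ := h.preconnected ⟨x, hx⟩ ⟨y, hy⟩
  exact ⟨p.length, (nearIn_iff_induce hx hy).2 ⟨p, le_rfl⟩⟩

theorem distIn_self (hx : x ∈ S) : distIn G S x x = 0 :=
  Nat.le_zero.1 (NearIn.refl hx 0).distIn_le

theorem distIn_comm (x y : α) : distIn G S x y = distIn G S y x :=
  congrArg sInf (Set.ext fun _ => ⟨NearIn.symm, NearIn.symm⟩)

/-- The union of the geodesics from `x` to `y` in the subgraph induced on `S`. -/
def seg (G : SimpleGraph α) (S : Set α) (x y : α) : Set α :=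
  {v | v ∈ S ∧ distIn G S x v + distIn G S v y = distIn G S x y}

theorem seg_comm (x y : α) : seg G S x y = seg G S y x := by
  ext v
  change (_ ∧ _) ↔ (_ ∧ _)
  rw [distIn_comm x v, distIn_comm v y, distIn_comm x y, add_comm]

theorem left_mem_seg (hx : x ∈ S) : x ∈ seg G S x y :=
  ⟨hx, by rw [distIn_self hx, zero_add]⟩

theorem right_mem_seg (hy : y ∈ S) : y ∈ seg G S x y :=
  ⟨hy, by rw [distIn_self hy, add_zero]⟩

/-- `p` is a geodesic of the subgraph induced on `S`. -/
structure IsGeodIn (G : SimpleGraph α) (S : Set α) (p : G.Walk x y) : Prop where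
  length_eq : p.length = distIn G S x y
  support_subset : ∀ v ∈ p.support, v ∈ S

namespace ConnIn

theorem nearIn (hS : ConnIn G S) (hx : x ∈ S) (hy : y ∈ S) :
    NearIn G S (distIn G S x y) x y := Nat.sInf_mem (s := {n | NearIn G S n x y}) (hS x hx y hy)

theorem triangle (hS : ConnIn G S) (hx : x ∈ S) (hy : y ∈ S) (hz : z ∈ S) :
    distIn G S x z ≤ distIn G S x y + distIn G S y z :=
  ((hS.nearIn hx hy).trans (hS.nearIn hy hz)).distIn_le

theorem exists_geod (hS : ConnIn G S) (hx : x ∈ S) (hy : y ∈ S) :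
    ∃ p : G.Walk x y, IsGeodIn G S p := by
  obtain ⟨p, hp, hpS⟩ := hS.nearIn hx hy
  exact ⟨p, le_antisymm hp (NearIn.distIn_le ⟨p, le_rfl, hpS⟩), hpS⟩

theorem eq_of_distIn_eq_zero (hS : ConnIn G S) (hx : x ∈ S) (hy : y ∈ S)
    (h : distIn G S x y = 0) : x = y := by
  obtain ⟨p, hp, -⟩ := hS.nearIn hx hy
  exact Walk.eq_of_length_eq_zero (p := p) (by omega)

end ConnIn

namespace IsGeodIn

variable {p : G.Walk x y}

theorem reverse (hp : IsGeodIn G S p) : IsGeodIn G S p.reverse :=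
  ⟨by rw [Walk.length_reverse, hp.1, distIn_comm], by simpa using hp.2⟩

theorem append_left {q : G.Walk x z} {r : G.Walk z y} (h : IsGeodIn G S (q.append r)) :
    IsGeodIn G S q := by
  have hq : ∀ v ∈ q.support, v ∈ S := fun v hv =>
    h.2 v ((Walk.mem_support_append_iff _ _).2 (Or.inl hv))
  have hr : ∀ v ∈ r.support, v ∈ S := fun v hv =>
    h.2 v ((Walk.mem_support_append_iff _ _).2 (Or.inr hv))
  refine ⟨le_antisymm ?_ (NearIn.distIn_le ⟨q, le_rfl, hq⟩), hq⟩
  have hne : {n | NearIn G S n x z}.Nonempty := ⟨_, q, le_rfl, hq⟩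
  have h₁ : NearIn G S (distIn G S x z) x z := Nat.sInf_mem hne
  have h₂ := (h₁.trans ⟨r, le_rfl, hr⟩).distIn_le
  have h₃ := h.1
  rw [Walk.length_append] at h₃
  omega

theorem append_right {q : G.Walk x z} {r : G.Walk z y} (h : IsGeodIn G S (q.append r)) :
    IsGeodIn G S r := by
  have h' := h.reverse
  rw [Walk.reverse_append] at h'
  have := h'.append_left.reverse
  rwa [Walk.reverse_reverse] at this

theorem mem_seg (hp : IsGeodIn G S p) (hv : v ∈ p.support) : v ∈ seg G S x y := by
  obtain ⟨q, r, rfl⟩ := Walk.mem_support_iff_exists_append.1 hv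
  refine ⟨hp.2 v hv, ?_⟩
  rw [← hp.append_left.1, ← hp.append_right.1, ← hp.1, Walk.length_append]

theorem nearIn_support (hp : IsGeodIn G S p) (hu : u ∈ p.support) (hv : v ∈ p.support) :
    NearIn G {w | w ∈ p.support} (distIn G S u v) u v := by
  obtain ⟨q, r, rfl⟩ := Walk.mem_support_iff_exists_append.1 hu
  rcases (Walk.mem_support_append_iff _ _).1 hv with h | h
  · obtain ⟨a, b, rfl⟩ := Walk.mem_support_iff_exists_append.1 h
    have := hp.append_left.append_right.reverse
    refine ⟨b.reverse, this.1.le, fun w hw => ?_⟩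
    rw [Walk.support_reverse, List.mem_reverse] at hw
    exact (Walk.mem_support_append_iff _ _).2 (Or.inl ((Walk.mem_support_append_iff _ _).2
        (Or.inr hw)))
  · obtain ⟨a, b, rfl⟩ := Walk.mem_support_iff_exists_append.1 h
    have := hp.append_right.append_left
    refine ⟨a, this.1.le, fun w hw => ?_⟩
    exact (Walk.mem_support_append_iff _ _).2 (Or.inr ((Walk.mem_support_append_iff _ _).2
        (Or.inl hw)))

end IsGeodIn

namespace ConnIn

theorem nearIn_of_seg_subset (hS : ConnIn G S) (hx : x ∈ S) (hy : y ∈ S)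
    (hT : seg G S x y ⊆ T) : NearIn G T (distIn G S x y) x y := by
  obtain ⟨p, hp⟩ := hS.exists_geod hx hy
  exact ⟨p, hp.1.le, fun v hv => hT (hp.mem_seg hv)⟩

theorem exists_mem_seg (hS : ConnIn G S) (hx : x ∈ S) (hy : y ∈ S)
    (hn : n ≤ distIn G S x y) : ∃ v ∈ seg G S x y, distIn G S x v = n := by
  obtain ⟨p, hp⟩ := hS.exists_geod hx hy
  refine ⟨p.getVert n, hp.mem_seg (p.getVert_mem_support n), ?_⟩
  have h := hp
  rw [← p.append_take_drop_eq n] at h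
  rw [← h.append_left.1, Walk.take_length, hp.1]
  omega

theorem exists_adj_seg (hS : ConnIn G S) (hx : x ∈ S) (hy : y ∈ S) (hne : x ≠ y) :
    ∃ v ∈ S, G.Adj x v ∧ distIn G S v y + 1 = distIn G S x y := by
  obtain ⟨p, hp⟩ := hS.exists_geod hx hy
  cases p with
  | nil => exact absurd rfl hne
  | @cons _ v _ h q =>
    have hp' : IsGeodIn G S ((h.toWalk).append q) := hp
    refine ⟨v, hp'.append_right.2 v q.start_mem_support, h, ?_⟩
    rw [← hp'.append_right.1, ← hp.1, Walk.length_cons]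

theorem seg_trans (hS : ConnIn G S) (hx : x ∈ S) (hy : y ∈ S) (hu : u ∈ seg G S x y)
    (hv : v ∈ seg G S x u) : v ∈ seg G S x y := by
  have h₁ := hS.triangle hv.1 hu.1 hy
  have h₂ := hS.triangle hx hv.1 hy
  have := hu.2
  have := hv.2
  exact ⟨hv.1, by omega⟩

end ConnIn

/-- Slimness of geodesic triangles in the subgraph induced on `S`, where one side is an arbitrary
geodesic. -/
structure SlimIn (G : SimpleGraph α) (N : ℕ) (S : Set α) : Prop where
  conn : ConnIn G S
  slim : ∀ x ∈ S, ∀ y ∈ S, ∀ z ∈ S, ∀ p : G.Walk x z, IsGeodIn G S p → ∀ u ∈ seg G S x y,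
    ∃ v ∈ S, (v ∈ seg G S y z ∨ v ∈ p.support) ∧ distIn G S u v ≤ N

theorem SlimIn.slim_seg {N : ℕ} (h : SlimIn G N S) (hx : x ∈ S) (hy : y ∈ S) (hz : z ∈ S)
    (hu : u ∈ seg G S x y) :
    ∃ v ∈ S, (v ∈ seg G S y z ∨ v ∈ seg G S x z) ∧ distIn G S u v ≤ N := by
  obtain ⟨p, hp⟩ := h.conn.exists_geod hx hz
  obtain ⟨v, hv, hv', huv⟩ := h.slim x hx y hy z hz p hp u hu
  exact ⟨v, hv, hv'.imp_right fun h => hp.mem_seg h, huv⟩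

theorem ConnIn.nearIn_of_isQIEmbedding {δ : ℝ} {D : ℕ} (hS : ConnIn G S) (hδ : 0 < δ)
    (hδD : δ ≤ D) (hδD' : δ * δ ≤ D) (hST : S ⊆ T)
    (hqi : IsQIEmbedding δ δ (G.induce S) (G.induce T) (Set.inclusion hST)) (hx : x ∈ S)
    (hy : y ∈ S) (hxy : NearIn G T m x y) : NearIn G S (D * m + D) x y := by
  refine (hS.nearIn hx hy).le ?_
  have hlow := (hqi ⟨x, hx⟩ ⟨y, hy⟩).2.1
  rw [← distIn_eq_dist hx hy] at hlow
  have hup : ((G.induce T).dist (Set.inclusion hST ⟨x, hx⟩) (Set.inclusion hST ⟨y, hy⟩) : ℝ) ≤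
      m := by
    exact_mod_cast (distIn_eq_dist (hST hx) (hST hy)).symm.trans_le hxy.distIn_le
  have hdist : (distIn G S x y : ℝ) ≤ (m + δ) * δ := by
    rw [← div_le_iff₀ hδ]
    linarith
  have hmul : (m : ℝ) * δ ≤ m * D := mul_le_mul_of_nonneg_left hδD (Nat.cast_nonneg m)
  have hcast : (distIn G S x y : ℝ) ≤ ((D * m + D : ℕ) : ℝ) := by
    push_cast
    linarith
  exact_mod_cast hcast

theorem isHyperbolicGraph_mono {δ ε : ℝ} (h : IsHyperbolicGraph δ G) (hδε : δ ≤ ε) :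
    IsHyperbolicGraph ε G :=
  ⟨h.1, fun x y z p q r hp hq hr a ha =>
    let ⟨b, hb, hab⟩ := h.2 x y z p q r hp hq hr a ha
    ⟨b, hb, hab.trans hδε⟩⟩

theorem slimIn_of_isHyperbolicGraph {N : ℕ} (h : IsHyperbolicGraph N (G.induce S)) :
    SlimIn G N S := by
  have hS := connIn_of_connected h.1
  refine ⟨hS, fun x hx y hy z hz p hp u hu => ?_⟩
  have hlen : ∀ {a b : α} (q : G.Walk a b) (hq : IsGeodIn G S q),
      (q.induce S hq.2).length = (G.induce S).dist ⟨a, hq.2 _ q.start_mem_support⟩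
        ⟨b, hq.2 _ q.end_mem_support⟩ := by
    intro a b q hq
    rw [length_induce, hq.1]
    exact distIn_eq_dist _ _
  obtain ⟨q, hq⟩ := hS.exists_geod hy hz
  obtain ⟨r₁, hr₁⟩ := hS.exists_geod hx hu.1
  obtain ⟨r₂, hr₂⟩ := hS.exists_geod hu.1 hy
  have hr : IsGeodIn G S (r₁.append r₂) := by
    refine ⟨by rw [Walk.length_append, hr₁.1, hr₂.1, hu.2], fun v hv => ?_⟩
    rcases (Walk.mem_support_append_iff _ _).1 hv with hv | hv
    exacts [hr₁.2 v hv, hr₂.2 v hv]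
  obtain ⟨b, hb, hub⟩ := h.2 _ _ _ _ _ _ (hlen _ hr) (hlen _ hq) (hlen _ hp) ⟨u, hu.1⟩
    (by simp)
  refine ⟨b.1, b.2, ?_, ?_⟩
  · rw [Walk.support_induce, Walk.support_induce] at hb
    simp only [List.mem_attachWith] at hb
    exact hb.imp_left fun h => hq.mem_seg h
  · rw [distIn_eq_dist hu.1 b.2]
    exact_mod_cast hub

/-- The restriction of a slim family to the subgraph induced on `S`: the sets `L x y`, for `x` and
`y` in `S`, are considered up to intersection with `S`, and distances are measured inside `S`. -/
structure IsSlimFamilyIn (G : SimpleGraph α) (S : Set α) (L : α → α → Set α) (h : ℕ) : Prop where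
  walk : ∀ x ∈ S, ∀ y ∈ S, ∃ n, NearIn G (S ∩ L x y) n x y
  small : ∀ x ∈ S, ∀ y ∈ S, NearIn G S 1 x y → ∀ v ∈ S, v ∈ L x y → NearIn G S h v x
  slim : ∀ x ∈ S, ∀ y ∈ S, ∀ z ∈ S, ∀ v ∈ S, v ∈ L x y →
    ∃ w, (w ∈ L x z ∨ w ∈ L z y) ∧ NearIn G S h v w

theorem IsSlimFamilyIn.connIn {L : α → α → Set α} {h : ℕ} (hL : IsSlimFamilyIn G S L h) :
    ConnIn G S := fun x hx y hy =>
  (hL.walk x hx y hy).imp fun _ hn => hn.mono Set.inter_subset_left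

theorem IsSlimFamilyIn.induce {L : α → α → Set α} {h : ℕ} (hL : IsSlimFamilyIn G S L h) :
    IsSlimFamily (G.induce S) (fun x y => {v | v.1 ∈ L x y}) h where
  walk x y := by
    obtain ⟨n, p, -, hp⟩ := hL.walk x x.2 y y.2
    refine ⟨p.induce S fun v hv => (hp v hv).1, fun v hv => (hp v ?_).2⟩
    rw [Walk.support_induce] at hv
    simpa using hv
  small x y hxy v hv := by
    rw [← distIn_eq_dist x.2 y.2] at hxy
    rw [← distIn_eq_dist v.2 x.2]
    have hxy' := (hL.connIn.nearIn x.2 y.2).le hxy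
    exact (hL.small x x.2 y y.2 hxy' v v.2 hv).distIn_le
  slim x y z v hv := by
    obtain ⟨w, hw, hvw⟩ := hL.slim x x.2 y y.2 z z.2 v v.2 hv
    refine ⟨⟨w, hvw.right_mem⟩, hw, ?_⟩
    rw [← distIn_eq_dist v.2 hvw.right_mem]
    exact hvw.distIn_le

theorem exists_isHyperbolicGraph_of_isSlimFamilyIn (h : ℕ) :
    ∃ N : ℕ, ∀ (α : Type*) (G : SimpleGraph α) (S : Set α) (L : α → α → Set α), S.Nonempty →
      IsSlimFamilyIn G S L h → IsHyperbolicGraph N (G.induce S) := by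
  obtain ⟨N, hN⟩ := exists_isHyperbolicGraph_of_isSlimFamily h
  refine ⟨N, fun α G S L hne hL => ?_⟩
  have : Nonempty S := hne.to_subtype
  exact hN S (G.induce S) _ hL.induce

end InducedSubgraphs

section CoarseRetractions

variable {α : Type*} {G : SimpleGraph α} {S T : Set α} {ρ : α → α} {r n : ℕ} {x y : α}

/-- `ρ` is a retraction of `S` onto `T` that moves the vertices of `S` by at most `r` and the ends
of an edge of `S` to vertices at distance at most `r` in `T`. -/
structure IsCoarseRetraction (G : SimpleGraph α) (S T : Set α) (ρ : α → α) (r : ℕ) : Prop where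
  subset : T ⊆ S
  mapsTo : Set.MapsTo ρ S T
  fixed : ∀ x ∈ T, ρ x = x
  near : ∀ x ∈ S, NearIn G S r x (ρ x)
  adj : ∀ x ∈ S, ∀ y ∈ S, G.Adj x y → NearIn G T r (ρ x) (ρ y)

namespace IsCoarseRetraction

theorem nearIn_walk (h : IsCoarseRetraction G S T ρ r) (p : G.Walk x y)
    (hp : ∀ v ∈ p.support, v ∈ S) :
    NearIn G (T ∩ {v | ∃ u ∈ p.support, NearIn G S (2 * r) v u}) (r * p.length) (ρ x) (ρ y) := by
  induction p with
  | @nil x =>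
    have hx : x ∈ S := hp x (by simp)
    refine NearIn.refl ?_ _
    exact ⟨h.mapsTo hx, x, by simp, (h.near x hx).symm.le (by omega)⟩
  | @cons x u y hxu q ih =>
    have hx : x ∈ S := hp x (by simp)
    have hq : ∀ v ∈ q.support, v ∈ S := fun v hv => hp v (by simp [hv])
    have hstep := (h.adj x hx u (hq u q.start_mem_support) hxu).inter_ball
    rw [Walk.length_cons, mul_add_one, add_comm]
    refine (hstep.mono ?_).trans ((ih hq).mono ?_)
    · rintro v ⟨hv, hvx⟩
      exact ⟨hv, x, by simp, ((hvx.mono h.subset).trans (h.near x hx).symm).le (by omega)⟩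
    · rintro v ⟨hv, t, ht, hvt⟩
      exact ⟨hv, t, by simp [ht], hvt⟩

theorem nearIn (h : IsCoarseRetraction G S T ρ r) (hxy : NearIn G S n x y) (hx : x ∈ T)
    (hy : y ∈ T) : NearIn G T (r * n) x y := by
  obtain ⟨p, hp, hS⟩ := hxy
  have := h.nearIn_walk p hS
  rw [h.fixed x hx, h.fixed y hy] at this
  exact (this.mono Set.inter_subset_left).le (Nat.mul_le_mul_left r hp)

theorem isSlimFamilyIn {N : ℕ} (h : IsCoarseRetraction G S T ρ r) (hS : SlimIn G N S) :
    IsSlimFamilyIn G T (fun x y => {v | ∃ u ∈ seg G S x y, NearIn G S (2 * r) v u})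
      (r * (3 * r + N + 1)) where
  walk x hx y hy := by
    obtain ⟨p, hp⟩ := hS.conn.exists_geod (h.subset hx) (h.subset hy)
    have := h.nearIn_walk p hp.2
    rw [h.fixed x hx, h.fixed y hy] at this
    refine ⟨_, this.mono ?_⟩
    rintro v ⟨hv, u, hu, hvu⟩
    exact ⟨hv, u, hp.mem_seg hu, hvu⟩
  small := by
    rintro x hx y - hxy v hv ⟨u, hu, hvu⟩
    have hd := (hxy.mono h.subset).distIn_le
    have hux : NearIn G S 1 u x :=
      (hS.conn.nearIn (h.subset hx) hu.1).symm.le (by have := hu.2; omega)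
    exact (h.nearIn (hvu.trans hux) hv hx).le (Nat.mul_le_mul_left r (by omega))
  slim := by
    rintro x hx y hy z hz v hv ⟨u, hu, hvu⟩
    obtain ⟨w, hw, hws, huw⟩ := hS.slim_seg (h.subset hx) (h.subset hy) (h.subset hz) hu
    have hnear : NearIn G S (2 * r) (ρ w) w := (h.near w hw).symm.le (by omega)
    refine ⟨ρ w, ?_, ?_⟩
    · rw [seg_comm z y]
      exact hws.symm.imp (fun hs => ⟨w, hs, hnear⟩) (fun hs => ⟨w, hs, hnear⟩)
    · have hvw := (hvu.trans ((hS.conn.nearIn hu.1 hw).le huw)).trans (h.near w hw)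
      exact (h.nearIn hvw hv (h.mapsTo hw)).le (Nat.mul_le_mul_left r (by omega))

end IsCoarseRetraction

theorem exists_isHyperbolicGraph_of_isCoarseRetraction (N r : ℕ) :
    ∃ N' : ℕ, ∀ (α : Type*) (G : SimpleGraph α) (S T : Set α) (ρ : α → α), T.Nonempty →
      SlimIn G N S → IsCoarseRetraction G S T ρ r → IsHyperbolicGraph N' (G.induce T) := by
  obtain ⟨N', hN'⟩ := exists_isHyperbolicGraph_of_isSlimFamilyIn (r * (3 * r + N + 1))
  exact ⟨N', fun α G S T ρ hne hS h => hN' α G T _ hne (h.isSlimFamilyIn hS)⟩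

end CoarseRetractions

section Cones

variable {α : Type*} {G : SimpleGraph α} {A B : Set α} {C : α → Set α} {N : ℕ}
  {a a' b c p q u v x y z : α}

/-- The neighbours of `b` at which geodesics from `x` to `b` inside `A` enter `b`. -/
def proj (G : SimpleGraph α) (A : Set α) (b x : α) : Set α :=
  {a | a ∈ A ∧ G.Adj a b ∧ distIn G A x a + 1 = distIn G A x b}

namespace ConnIn

theorem proj_nonempty (hA : ConnIn G A) (hb : b ∈ A) (hx : x ∈ A) (hne : x ≠ b) :
    (proj G A b x).Nonempty := by
  obtain ⟨a, ha, hab, h⟩ := hA.exists_adj_seg hb hx hne.symm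
  exact ⟨a, ha, hab.symm, by rw [distIn_comm x a, distIn_comm x b, h]⟩

theorem mem_seg_of_mem_proj (hA : ConnIn G A) (hb : b ∈ seg G A x y) (hx : x ∈ A) (hy : y ∈ A)
    (ha : a ∈ proj G A b x) : a ∈ seg G A x y := by
  have h₁ := (NearIn.of_adj ha.2.1 ha.1 hb.1).distIn_le
  have h₂ := hA.triangle ha.1 hb.1 hy
  have h₃ := hA.triangle hx ha.1 hy
  have := ha.2.2
  have := hb.2
  exact ⟨ha.1, by omega⟩

theorem proj_subset (hA : ConnIn G A) (hx : x ∈ A) (hy : y ∈ A) (hu : u ∈ seg G A x y)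
    (hb : b ∈ seg G A u y) : proj G A b u ⊆ proj G A b x := by
  intro a ha
  have h₁ := hA.triangle hx hu.1 ha.1
  have h₂ := hA.triangle hx hb.1 hy
  have h₃ := (NearIn.of_adj ha.2.1 ha.1 hb.1).distIn_le
  have h₄ := hA.triangle hx ha.1 hb.1
  have := ha.2.2
  have := hu.2
  have := hb.2
  exact ⟨ha.1, ha.2.1, by omega⟩

theorem seg_trans_right (hA : ConnIn G A) (hx : x ∈ A) (hy : y ∈ A) (hu : u ∈ seg G A x y)
    (hv : v ∈ seg G A u y) : v ∈ seg G A x y := by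
  rw [seg_comm] at hu hv ⊢
  exact hA.seg_trans hy hx hu hv

theorem nearIn_diff (hA : ConnIn G A) (hx : x ∈ A) (hy : y ∈ A) (hb : b ∉ seg G A x y) :
    NearIn G (A \ {b}) (distIn G A x y) x y :=
  hA.nearIn_of_seg_subset hx hy fun v hv => ⟨hv.1, by rintro rfl; exact hb hv⟩

theorem notMem_seg_or_notMem_seg (hA : ConnIn G A) (hx : x ∈ A) (hy : y ∈ A) (hp : p ∈ seg G A x y)
    (hbA : b ∈ A) (hpb : p ≠ b) : b ∉ seg G A x p ∨ b ∉ seg G A p y := by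
  by_contra! h
  obtain ⟨h₁, h₂⟩ := h
  refine hpb (hA.eq_of_distIn_eq_zero hp.1 hbA ?_)
  have h₃ := hA.triangle hx hbA hy
  have := hp.2
  have := h₁.2
  have := h₂.2
  have := distIn_comm (G := G) (S := A) b p
  omega

end ConnIn

namespace SlimIn

/-- Slimness is applied at the point of a geodesic from `a` to `x` at distance `2 * N + 3` from `a`,
which is too far from `b` for the comparison paths to pass through `b`. -/
theorem exists_near_proj (hA : SlimIn G N A) (hb : b ∈ A) (hx : x ∈ A) (hy : y ∈ A)
    (γ : G.Walk x y) (hγ : IsGeodIn G A γ) (ha : a ∈ proj G A b x) (ha' : a' ∈ proj G A b y) :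
    ∃ v, NearIn G (A \ {b}) (4 * N + 3) a v ∧ (v ∈ γ.support ∨ v ∈ seg G A a' y) := by
  have hc := hA.conn
  have hxa := ha.2.2
  by_cases hs : distIn G A x a ≤ 2 * N + 3
  · refine ⟨x, (hc.nearIn_diff hx ha.1 fun h => ?_).symm.le
      (by omega), Or.inl γ.start_mem_support⟩
    have := h.2
    omega
  obtain ⟨u, hu, hxu⟩ := hc.exists_mem_seg hx ha.1 (n := distIn G A x a - (2 * N + 3)) (by omega)
  have hua := hu.2
  have hub := hc.triangle hx hu.1 hb
  obtain ⟨v₁, hv₁, hv₁', huv₁⟩ := hA.slim_seg hx ha.1 ha'.1 hu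
  rcases hv₁' with hv₁' | hv₁'
  · exfalso
    have h₁ := (NearIn.of_adj ha.2.1 ha.1 hb).distIn_le
    have h₂ := (NearIn.of_adj ha'.2.1 ha'.1 hb).distIn_le
    have h₃ := hc.triangle ha.1 hb ha'.1
    have h₄ := hc.triangle hu.1 hv₁ ha.1
    have := hv₁'.2
    rw [distIn_comm b a'] at h₃
    rw [distIn_comm v₁ a] at h₄
    omega
  obtain ⟨v, hv, hv', hv₁v⟩ := hA.slim x hx a' ha'.1 y hy γ hγ v₁ hv₁'
  have h₁ : b ∉ seg G A u v₁ := fun h => by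
    have := h.2
    omega
  have h₂ : b ∉ seg G A v₁ v := fun h => by
    have := h.2
    have := hc.triangle hu.1 hv₁ hb
    omega
  have h₃ : b ∉ seg G A u a := fun h => by
    have := h.2
    omega
  refine ⟨v, ?_, hv'.symm⟩
  exact ((hc.nearIn_diff hu.1 ha.1 h₃).symm.trans ((hc.nearIn_diff hu.1 hv₁ h₁).trans
    (hc.nearIn_diff hv₁ hv h₂))).le (by omega)

theorem nearIn_of_near_proj (hA : SlimIn G N A) (hb : b ∈ A) (hy : y ∈ A) (ha : a ∈ A)
    (ha' : a' ∈ proj G A b y) (haa' : distIn G A a a' ≤ 2)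
    (hav : NearIn G (A \ {b}) (4 * N + 3) a v) (hv : v ∈ seg G A a' y) :
    NearIn G (A \ {b}) (16 * N + 14) a a' := by
  have hc := hA.conn
  have hbv : b ∉ seg G A v a' := fun h => by
    have h₁ := h.2
    have h₂ := hv.2
    have h₃ := ha'.2.2
    have h₄ := hc.triangle hy hv.1 hb
    rw [distIn_comm y a'] at h₃
    rw [distIn_comm y v] at h₄
    rw [distIn_comm v a'] at h₁
    omega
  have hva := (hav.mono Set.sdiff_subset).symm.distIn_le
  have htri := hc.triangle hv.1 ha ha'.1
  exact (hav.trans (hc.nearIn_diff hv.1 ha'.1 hbv)).le (by omega)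

/-- The *bounded geodesic image* property of the cone point `b`. -/
theorem nearIn_of_mem_proj (hA : SlimIn G N A) (hb : b ∈ A) (hx : x ∈ A) (hy : y ∈ A)
    (hbs : b ∉ seg G A x y) (ha : a ∈ proj G A b x) (ha' : a' ∈ proj G A b y) :
    NearIn G (A \ {b}) (16 * N + 14) a a' := by
  have hc := hA.conn
  have haa' := ((NearIn.of_adj ha.2.1 ha.1 hb).trans
    (NearIn.of_adj ha'.2.1 ha'.1 hb).symm).distIn_le
  obtain ⟨γ, hγ⟩ := hc.exists_geod hx hy
  obtain ⟨v, hav, hv⟩ := hA.exists_near_proj hb hx hy γ hγ ha ha'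
  obtain ⟨v', hav', hv'⟩ := hA.exists_near_proj hb hy hx γ.reverse hγ.reverse ha' ha
  rcases hv with hv | hv
  · rcases hv' with hv' | hv'
    · rw [Walk.support_reverse, List.mem_reverse] at hv'
      have h₁ := (hav.mono Set.sdiff_subset).symm.distIn_le
      have h₂ := (hav'.mono Set.sdiff_subset).distIn_le
      have h₃ := hc.triangle (hγ.2 v hv) ha.1 ha'.1
      have h₄ := hc.triangle (hγ.2 v hv) ha'.1 (hγ.2 v' hv')
      have hvv' : NearIn G (A \ {b}) (distIn G A v v') v v' :=
        (hγ.nearIn_support hv hv').mono fun w hw =>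
          ⟨hγ.2 w hw, fun hwb => hbs (hwb ▸ hγ.mem_seg hw)⟩
      exact ((hav.trans hvv').trans hav'.symm).le (by omega)
    · exact (hA.nearIn_of_near_proj hb hx ha'.1 ha (by rwa [distIn_comm]) hav' hv').symm
  · exact hA.nearIn_of_near_proj hb hy ha.1 ha' haa' hav hv

end SlimIn

/-- The vertices in `B` are cone points of the slim graph induced on `A`; the base of the cone at
`b` lies in the slim subgraph `C b`, which is quasi-isometrically embedded away from `b`. -/
structure IsConeFamily (G : SimpleGraph α) (A B : Set α) (C : α → Set α) (N : ℕ) : Prop where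
  slim : SlimIn G N A
  subset : B ⊆ A
  base_subset : ∀ b ∈ B, C b ⊆ A \ B
  adj_mem : ∀ b ∈ B, ∀ a ∈ A, G.Adj a b → a ∈ C b
  base_slim : ∀ b ∈ B, SlimIn G N (C b)
  base_embed : ∀ b ∈ B, ∀ x ∈ C b, ∀ y ∈ C b, ∀ n,
    NearIn G (A \ {b}) n x y → NearIn G (C b) (N * n + N) x y

/-- A bound for the diameter, in the base of a cone, of the projection of a geodesic missing the
cone point. -/
def projDiam (N : ℕ) : ℕ := N * (16 * N + 14) + N

/-- A bound for the distance from a side of a de-coned triangle to the union of the other two. -/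
def deconedSlimness (N : ℕ) : ℕ := (4 * projDiam N + 1) * (N + 1) + 4 * projDiam N + N

/-- Geodesics in `A`, with passages through cone points replaced by geodesics in the bases. -/
def deconedSeg (G : SimpleGraph α) (A B : Set α) (C : α → Set α) (x y : α) : Set α :=
  {v | (v ∈ seg G A x y ∧ v ∉ B) ∨ ∃ b ∈ B, b ∈ seg G A x y ∧
    ∃ a ∈ proj G A b x, ∃ a' ∈ proj G A b y, v ∈ seg G (C b) a a'}

theorem deconedSeg_comm (x y : α) : deconedSeg G A B C x y = deconedSeg G A B C y x := by
  have key : ∀ x y : α, deconedSeg G A B C x y ⊆ deconedSeg G A B C y x := by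
    rintro x y v (⟨hv, hvB⟩ | ⟨b, hb, hbs, a, ha, a', ha', hv⟩)
    · exact Or.inl ⟨by rwa [seg_comm], hvB⟩
    · exact Or.inr ⟨b, hb, by rwa [seg_comm], a', ha', a, ha, by rwa [seg_comm]⟩
  exact (key x y).antisymm (key y x)

namespace IsConeFamily

theorem mem_base (h : IsConeFamily G A B C N) (hb : b ∈ B) (ha : a ∈ proj G A b x) : a ∈ C b :=
  h.adj_mem b hb a ha.1 ha.2.1

theorem proj_nonempty (h : IsConeFamily G A B C N) (hb : b ∈ B) (hx : x ∈ A \ B) :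
    (proj G A b x).Nonempty :=
  h.slim.conn.proj_nonempty (h.subset hb) hx.1 (by rintro rfl; exact hx.2 hb)

theorem nearIn_base (h : IsConeFamily G A B C N) (hb : b ∈ B) (hx : x ∈ A) (hy : y ∈ A)
    (hbs : b ∉ seg G A x y) (ha : a ∈ proj G A b x) (ha' : a' ∈ proj G A b y) :
    NearIn G (C b) (projDiam N) a a' :=
  h.base_embed b hb a (h.mem_base hb ha) a' (h.mem_base hb ha') _
    (h.slim.nearIn_of_mem_proj (h.subset hb) hx hy hbs ha ha')

theorem deconedSeg_subset (h : IsConeFamily G A B C N) (hx : x ∈ A) (hy : y ∈ A)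
    (hu : u ∈ seg G A x y) : deconedSeg G A B C u y ⊆ deconedSeg G A B C x y := by
  have hc := h.slim.conn
  rintro v (⟨hv, hvB⟩ | ⟨b, hb, hbs, a, ha, a', ha', hv⟩)
  · exact Or.inl ⟨hc.seg_trans_right hx hy hu hv, hvB⟩
  · exact Or.inr ⟨b, hb, hc.seg_trans_right hx hy hu hbs, a, hc.proj_subset hx hy hu hbs ha, a',
      ha', hv⟩

theorem exists_next (h : IsConeFamily G A B C N) (hx : x ∈ A \ B) (hy : y ∈ A \ B) (hne : x ≠ y) :
    (∃ u ∈ A \ B, G.Adj x u ∧ u ∈ seg G A x y ∧ distIn G A u y + 1 = distIn G A x y) ∨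
    ∃ b ∈ B, b ∈ seg G A x y ∧ x ∈ proj G A b x ∧ ∃ u ∈ A \ B, u ∈ proj G A b y ∧
      u ∈ seg G A x y ∧ distIn G A u y + 2 = distIn G A x y := by
  have hc := h.slim.conn
  obtain ⟨v, hv, hxv, hvy⟩ := hc.exists_adj_seg hx.1 hy.1 hne
  have hxv' := (NearIn.of_adj hxv hx.1 hv).distIn_le
  have htri := hc.triangle hx.1 hv hy.1
  have hvs : v ∈ seg G A x y := ⟨hv, by omega⟩
  by_cases hvB : v ∈ B
  · obtain ⟨u, hu, hvu, huy⟩ := hc.exists_adj_seg hv hy.1 (by rintro rfl; exact hy.2 hvB)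
    have huB : u ∈ A \ B := h.base_subset v hvB (h.adj_mem v hvB u hu hvu.symm)
    have hvu' := (NearIn.of_adj hvu hv hu).distIn_le
    have htri' := hc.triangle hv hu hy.1
    refine Or.inr ⟨v, hvB, hvs, ⟨hx.1, hxv, ?_⟩, u, huB, ⟨hu, hvu.symm, ?_⟩, ?_, by omega⟩
    · rw [distIn_self hx.1]
      omega
    · rw [distIn_comm y u, distIn_comm y v]
      omega
    · exact hc.seg_trans_right hx.1 hy.1 hvs ⟨hu, by omega⟩
  · exact Or.inl ⟨v, ⟨hv, hvB⟩, hxv, hvs, hvy⟩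

theorem exists_walk (h : IsConeFamily G A B C N) (m : ℕ) :
    ∀ x ∈ A \ B, ∀ y ∈ A \ B, distIn G A x y ≤ m →
      ∃ n, NearIn G ((A \ B) ∩ deconedSeg G A B C x y) n x y := by
  induction m using Nat.strong_induction_on with
  | _ m ih =>
  intro x hx y hy hm
  have hxs : x ∈ (A \ B) ∩ deconedSeg G A B C x y := ⟨hx, Or.inl ⟨left_mem_seg hx.1, hx.2⟩⟩
  by_cases hne : x = y
  · subst hne
    exact ⟨0, NearIn.refl hxs 0⟩
  have hmono : ∀ {u : α}, u ∈ seg G A x y → (A \ B) ∩ deconedSeg G A B C u y ⊆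
      (A \ B) ∩ deconedSeg G A B C x y := fun hu =>
    Set.inter_subset_inter_right _ (h.deconedSeg_subset hx.1 hy.1 hu)
  rcases h.exists_next hx hy hne with ⟨u, hu, hxu, hus, huy⟩ | ⟨b, hb, hbs, hxp, u, hu, hup, hus,
      huy⟩
  · obtain ⟨n, hn⟩ := ih (distIn G A u y) (by omega) u hu y hy le_rfl
    have hn' := hn.mono (hmono hus)
    exact ⟨_, (NearIn.of_adj hxu hxs hn'.left_mem).trans hn'⟩
  · obtain ⟨n, hn⟩ := ih (distIn G A u y) (by omega) u hu y hy le_rfl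
    have hn' := hn.mono (hmono hus)
    have hsub : seg G (C b) x u ⊆ (A \ B) ∩ deconedSeg G A B C x y := fun v hv =>
      ⟨h.base_subset b hb hv.1, Or.inr ⟨b, hb, hbs, x, hxp, u, hup, hv⟩⟩
    exact ⟨_, ((h.base_slim b hb).conn.nearIn_of_seg_subset (h.mem_base hb hxp)
      (h.mem_base hb hup) hsub).trans hn'⟩

theorem near_or_deep (h : IsConeFamily G A B C N) (T m : ℕ) :
    ∀ x ∈ A \ B, ∀ y ∈ A \ B, distIn G A x y ≤ m →
      NearIn G (A \ B) ((T + 1) * m) x y ∨ ∃ b ∈ B, b ∈ seg G A x y ∧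
        ∃ a ∈ proj G A b x, ∃ a' ∈ proj G A b y, ¬ NearIn G (C b) T a a' ∧
          NearIn G (A \ B) ((T + 1) * m) x a := by
  induction m using Nat.strong_induction_on with
  | _ m ih =>
  intro x hx y hy hm
  have hc := h.slim.conn
  by_cases hne : x = y
  · subst hne
    exact Or.inl (NearIn.refl hx _)
  have hstep : ∀ {u : α} {j i : ℕ}, u ∈ A \ B → NearIn G (A \ B) j x u → u ∈ seg G A x y →
      distIn G A u y + i = distIn G A x y → 0 < i → j ≤ (T + 1) * i →
      NearIn G (A \ B) ((T + 1) * m) x y ∨ ∃ b ∈ B, b ∈ seg G A x y ∧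
        ∃ a ∈ proj G A b x, ∃ a' ∈ proj G A b y, ¬ NearIn G (C b) T a a' ∧
          NearIn G (A \ B) ((T + 1) * m) x a := by
    intro u j i hu hxu hus hdist hi hj
    obtain ⟨m', rfl⟩ : ∃ m', m = m' + i := ⟨m - i, by omega⟩
    have hle : j + (T + 1) * m' ≤ (T + 1) * (m' + i) := by rw [mul_add]; omega
    rcases ih m' (by omega) u hu y hy (by omega) with hn | ⟨b, hb, hbs, a, ha, a', ha', hT, hn⟩
    · exact Or.inl ((hxu.trans hn).le hle)
    · exact Or.inr ⟨b, hb, hc.seg_trans_right hx.1 hy.1 hus hbs, a,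
        hc.proj_subset hx.1 hy.1 hus hbs ha, a', ha', hT, (hxu.trans hn).le hle⟩
  rcases h.exists_next hx hy hne with ⟨u, hu, hxu, hus, huy⟩ | ⟨b, hb, hbs, hxp, u, hu, hup, hus,
      huy⟩
  · exact hstep hu (NearIn.of_adj hxu hx hu) hus huy one_pos (by omega)
  · by_cases hT : NearIn G (C b) T x u
    · exact hstep hu (hT.mono (h.base_subset b hb)) hus huy two_pos (by omega)
    · exact Or.inr ⟨b, hb, hbs, x, hxp, u, hup, hT, NearIn.refl hx _⟩

theorem exists_near_deconedSeg_of_mem_proj (h : IsConeFamily G A B C N)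
    (hx : x ∈ A \ B) (hy : y ∈ A \ B) (hz : z ∈ A \ B)
    (hb : b ∈ B) (hbs : b ∈ seg G A x z ∨ b ∈ seg G A y z) (ha : a ∈ proj G A b x) :
    ∃ v ∈ deconedSeg G A B C x z ∪ deconedSeg G A B C y z,
      NearIn G (A \ B) (projDiam N) a v := by
  have haC := h.mem_base hb ha
  obtain ⟨c, hc⟩ := h.proj_nonempty hb hz
  have hcC := h.mem_base hb hc
  by_cases hxz : b ∈ seg G A x z
  · exact ⟨a, Or.inl (Or.inr ⟨b, hb, hxz, a, ha, c, hc, left_mem_seg haC⟩),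
      NearIn.refl (h.base_subset b hb haC) _⟩
  · have hyz : b ∈ seg G A y z := hbs.resolve_left hxz
    obtain ⟨d, hd⟩ := h.proj_nonempty hb hy
    exact ⟨c, Or.inr (Or.inr ⟨b, hb, hyz, d, hd, c, hc, right_mem_seg hcC⟩),
      (h.nearIn_base hb hx.1 hz.1 hxz ha hc).mono (h.base_subset b hb)⟩

theorem exists_near_deconedSeg_of_near_proj (h : IsConeFamily G A B C N) (hx : x ∈ A \ B)
    (hy : y ∈ A \ B) (hz : z ∈ A \ B) (hp : p ∈ seg G A x y) (hpB : p ∉ B) (hb : b ∈ B)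
    (hbs : b ∈ seg G A x z ∨ b ∈ seg G A y z) (ha : a ∈ proj G A b p) :
    ∃ v ∈ deconedSeg G A B C x z ∪ deconedSeg G A B C y z,
      NearIn G (A \ B) (2 * projDiam N) a v := by
  have hsub := h.base_subset b hb
  have hpb : p ≠ b := by rintro rfl; exact hpB hb
  rcases h.slim.conn.notMem_seg_or_notMem_seg hx.1 hy.1 hp (h.subset hb) hpb with hs | hs
  · obtain ⟨c, hc⟩ := h.proj_nonempty hb hx
    obtain ⟨v, hv, hcv⟩ := h.exists_near_deconedSeg_of_mem_proj hx hy hz hb hbs hc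
    exact ⟨v, hv, (((h.nearIn_base hb hx.1 hp.1 hs hc ha).symm.mono hsub).trans hcv).le
      (by omega)⟩
  · obtain ⟨c, hc⟩ := h.proj_nonempty hb hy
    obtain ⟨v, hv, hcv⟩ := h.exists_near_deconedSeg_of_mem_proj hy hx hz hb hbs.symm hc
    exact ⟨v, Or.symm hv, (((h.nearIn_base hb hp.1 hy.1 hs ha hc).mono hsub).trans hcv).le
      (by omega)⟩

theorem nearIn_base_of_notMem_sides (h : IsConeFamily G A B C N) (hx : x ∈ A \ B)
    (hy : y ∈ A \ B) (hz : z ∈ A \ B) (hp : p ∈ seg G A x y) (hpB : p ∉ B)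
    (hq : q ∈ seg G A x z) (hb : b ∈ B) (hxz : b ∉ seg G A x z) (hyz : b ∉ seg G A y z)
    (ha : a ∈ proj G A b p) (ha' : a' ∈ proj G A b q) :
    NearIn G (C b) (4 * projDiam N) a a' := by
  obtain ⟨ax, hax⟩ := h.proj_nonempty hb hx
  have hpb : p ≠ b := by rintro rfl; exact hpB hb
  have hxq := h.nearIn_base hb hx.1 hq.1
    (fun hb' => hxz (h.slim.conn.seg_trans hx.1 hz.1 hq hb')) hax ha'
  rcases h.slim.conn.notMem_seg_or_notMem_seg hx.1 hy.1 hp (h.subset hb) hpb with hs | hs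
  · exact ((h.nearIn_base hb hx.1 hp.1 hs hax ha).symm.trans hxq).le (by omega)
  · obtain ⟨ay, hay⟩ := h.proj_nonempty hb hy
    obtain ⟨az, haz⟩ := h.proj_nonempty hb hz
    have hpy := h.nearIn_base hb hp.1 hy.1 hs ha hay
    have hyz' := h.nearIn_base hb hy.1 hz.1 hyz hay haz
    have hzx := (h.nearIn_base hb hx.1 hz.1 hxz hax haz).symm
    exact (((hpy.trans hyz').trans hzx).trans hxq).le (by omega)

theorem slim_of_near_left (h : IsConeFamily G A B C N) (hx : x ∈ A \ B) (hy : y ∈ A \ B)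
    (hz : z ∈ A \ B) (hp : p ∈ seg G A x y) (hpB : p ∉ B) (hq : q ∈ seg G A x z) (hqB : q ∉ B)
    (hpq : distIn G A p q ≤ N + 1) :
    ∃ v ∈ deconedSeg G A B C x z ∪ deconedSeg G A B C y z,
      NearIn G (A \ B) ((4 * projDiam N + 1) * (N + 1) + 2 * projDiam N) p v := by
  rcases h.near_or_deep (4 * projDiam N) (N + 1) p ⟨hp.1, hpB⟩ q ⟨hq.1, hqB⟩ hpq with
    hn | ⟨b, hb, -, a, ha, a', ha', hT, hn⟩
  · exact ⟨q, Or.inl (Or.inl ⟨hq, hqB⟩), hn.le (by omega)⟩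
  by_cases hbs : b ∈ seg G A x z ∨ b ∈ seg G A y z
  · obtain ⟨v, hv, hav⟩ := h.exists_near_deconedSeg_of_near_proj hx hy hz hp hpB hb hbs ha
    exact ⟨v, hv, hn.trans hav⟩
  · rw [not_or] at hbs
    exact absurd (h.nearIn_base_of_notMem_sides hx hy hz hp hpB hq hb hbs.1 hbs.2 ha ha') hT

theorem exists_mem_seg_notMem (h : IsConeFamily G A B C N) (hx : x ∈ A) (hz : z ∈ A \ B)
    (hq : q ∈ seg G A x z) : ∃ q' ∈ seg G A x z, q' ∉ B ∧ distIn G A q q' ≤ 1 := by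
  have hc := h.slim.conn
  by_cases hqB : q ∈ B
  · obtain ⟨q', hq', hadj, hd⟩ := hc.exists_adj_seg hq.1 hz.1 (by rintro rfl; exact hz.2 hqB)
    have h₁ := (NearIn.of_adj hadj hq.1 hq').distIn_le
    have h₂ := hc.triangle hq.1 hq' hz.1
    exact ⟨q', hc.seg_trans_right hx hz.1 hq ⟨hq', by omega⟩,
      (h.base_subset q hqB (h.adj_mem q hqB q' hq' hadj.symm)).2, h₁⟩
  · exact ⟨q, hq, hqB, by rw [distIn_self hq.1]; omega⟩

theorem slim_of_mem_seg (h : IsConeFamily G A B C N)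
    (hx : x ∈ A \ B) (hy : y ∈ A \ B) (hz : z ∈ A \ B) (hp : p ∈ seg G A x y) (hpB : p ∉ B) :
    ∃ v ∈ deconedSeg G A B C x z ∪ deconedSeg G A B C y z,
      NearIn G (A \ B) ((4 * projDiam N + 1) * (N + 1) + 2 * projDiam N) p v := by
  have hc := h.slim.conn
  obtain ⟨q, -, hq | hq, hpq⟩ := h.slim.slim_seg hx.1 hy.1 hz.1 hp
  · obtain ⟨q', hq', hqB, hqq'⟩ := h.exists_mem_seg_notMem hy.1 hz hq
    have htri := hc.triangle hp.1 hq.1 hq'.1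
    rw [seg_comm] at hp
    obtain ⟨v, hv, hpv⟩ := h.slim_of_near_left hy hx hz hp hpB hq' hqB (by omega)
    exact ⟨v, Or.symm hv, hpv⟩
  · obtain ⟨q', hq', hqB, hqq'⟩ := h.exists_mem_seg_notMem hx.1 hz hq
    have htri := hc.triangle hp.1 hq.1 hq'.1
    exact h.slim_of_near_left hx hy hz hp hpB hq' hqB (by omega)

theorem slim_of_near_base_seg (h : IsConeFamily G A B C N) (hx : x ∈ A \ B) (hy : y ∈ A \ B)
    (hz : z ∈ A \ B) (hb : b ∈ B) (hbs : b ∈ seg G A x z ∨ b ∈ seg G A y z)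
    (ha : a ∈ proj G A b x) (hc : c ∈ proj G A b z) (hq : q ∈ seg G (C b) a c) :
    ∃ v ∈ deconedSeg G A B C x z ∪ deconedSeg G A B C y z,
      NearIn G (A \ B) (2 * projDiam N) q v := by
  have hsub := h.base_subset b hb
  by_cases hxz : b ∈ seg G A x z
  · exact ⟨q, Or.inl (Or.inr ⟨b, hb, hxz, a, ha, c, hc, hq⟩), NearIn.refl (hsub hq.1) _⟩
  · have hac := (h.nearIn_base hb hx.1 hz.1 hxz ha hc).distIn_le
    have hqa : NearIn G (A \ B) (projDiam N) q a :=
      (((h.base_slim b hb).conn.nearIn (h.mem_base hb ha) hq.1).symm.le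
        (by have := hq.2; omega)).mono hsub
    obtain ⟨v, hv, hav⟩ := h.exists_near_deconedSeg_of_mem_proj hx hy hz hb hbs ha
    exact ⟨v, hv, (hqa.trans hav).le (by omega)⟩

theorem slim_of_mem_base_seg (h : IsConeFamily G A B C N) (hx : x ∈ A \ B) (hy : y ∈ A \ B)
    (hz : z ∈ A \ B) (hb : b ∈ B) (hbs : b ∈ seg G A x y) (ha : a ∈ proj G A b x)
    (ha' : a' ∈ proj G A b y) (hp : p ∈ seg G (C b) a a') :
    ∃ v ∈ deconedSeg G A B C x z ∪ deconedSeg G A B C y z,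
      NearIn G (A \ B) (deconedSlimness N) p v := by
  rw [deconedSlimness]
  have hsub := h.base_subset b hb
  have hCb := h.base_slim b hb
  have haC := h.mem_base hb ha
  obtain ⟨c, hc⟩ := h.proj_nonempty hb hz
  by_cases hbs' : b ∈ seg G A x z ∨ b ∈ seg G A y z
  · obtain ⟨q, hqC, hq, hpq⟩ := hCb.slim_seg haC (h.mem_base hb ha') (h.mem_base hb hc) hp
    have hpq' : NearIn G (A \ B) N p q := ((hCb.conn.nearIn hp.1 hqC).le hpq).mono hsub
    rcases hq with hq | hq
    · obtain ⟨v, hv, hqv⟩ := h.slim_of_near_base_seg hy hx hz hb hbs'.symm ha' hc hq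
      exact ⟨v, Or.symm hv, (hpq'.trans hqv).le (by omega)⟩
    · obtain ⟨v, hv, hqv⟩ := h.slim_of_near_base_seg hx hy hz hb hbs' ha hc hq
      exact ⟨v, hv, (hpq'.trans hqv).le (by omega)⟩
  · rw [not_or] at hbs'
    have haa' := ((h.nearIn_base hb hx.1 hz.1 hbs'.1 ha hc).trans
      (h.nearIn_base hb hy.1 hz.1 hbs'.2 ha' hc).symm).distIn_le
    have hpa : NearIn G (A \ B) (2 * projDiam N) p a :=
      ((hCb.conn.nearIn haC hp.1).symm.le (by have := hp.2; omega)).mono hsub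
    obtain ⟨v, hv, hav⟩ := h.slim_of_mem_seg hx hy hz
      (h.slim.conn.mem_seg_of_mem_proj hbs hx.1 hy.1 ha) (hsub haC).2
    exact ⟨v, hv, (hpa.trans hav).le (by omega)⟩

theorem deconedSeg_small (h : IsConeFamily G A B C N) (hx : x ∈ A \ B) (hy : y ∈ A \ B)
    (hxy : NearIn G (A \ B) 1 x y) (hv : v ∈ deconedSeg G A B C x y) :
    NearIn G (A \ B) 1 v x := by
  have hc := h.slim.conn
  have hseg : ∀ {u : α}, u ∈ seg G A x y → u = x ∨ u = y := by
    intro u hu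
    have hd := (hxy.mono Set.sdiff_subset).distIn_le
    have := hu.2
    rcases (by omega : distIn G A x u = 0 ∨ distIn G A u y = 0) with h0 | h0
    · exact Or.inl (hc.eq_of_distIn_eq_zero hx.1 hu.1 h0).symm
    · exact Or.inr (hc.eq_of_distIn_eq_zero hu.1 hy.1 h0)
  rcases hv with ⟨hv, -⟩ | ⟨b, hb, hbs, -⟩
  · rcases hseg hv with rfl | rfl
    · exact NearIn.refl hx 1
    · exact hxy.symm
  · rcases hseg hbs with rfl | rfl
    · exact absurd hb hx.2
    · exact absurd hb hy.2

theorem isSlimFamilyIn (h : IsConeFamily G A B C N) :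
    IsSlimFamilyIn G (A \ B) (deconedSeg G A B C) (deconedSlimness N + 1) where
  walk x hx y hy := h.exists_walk _ x hx y hy le_rfl
  small x hx y hy hxy v _ hv := (h.deconedSeg_small hx hy hxy hv).le (by omega)
  slim := by
    intro x hx y hy z hz v _ hv
    rw [deconedSeg_comm z y]
    rcases hv with ⟨hv, hvB⟩ | ⟨b, hb, hbs, a, ha, a', ha', hv⟩
    · obtain ⟨w, hw, hvw⟩ := h.slim_of_mem_seg hx hy hz hv hvB
      exact ⟨w, hw, hvw.le (by rw [deconedSlimness]; omega)⟩
    · obtain ⟨w, hw, hvw⟩ := h.slim_of_mem_base_seg hx hy hz hb hbs ha ha' hv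
      exact ⟨w, hw, hvw.le (by omega)⟩

end IsConeFamily

theorem exists_isHyperbolicGraph_of_isConeFamily (N : ℕ) :
    ∃ N' : ℕ, ∀ (α : Type*) (G : SimpleGraph α) (A B : Set α) (C : α → Set α),
      (A \ B).Nonempty → IsConeFamily G A B C N → IsHyperbolicGraph N' (G.induce (A \ B)) := by
  obtain ⟨N', hN'⟩ := exists_isHyperbolicGraph_of_isSlimFamilyIn (deconedSlimness N + 1)
  exact ⟨N', fun α G A B C hne h => hN' α G _ _ hne h.isSlimFamilyIn⟩

end Cones

end HyperbolicGraph

namespace CHHF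

open SimpleGraph HyperbolicGraph

section Augmented

variable {V : Type u} {X : SimpleGraph V} {S H K : Set V} {W : SimpleGraph (MaxClique X S)}
  {v w : V}

theorem augAdj_inl_inr : (augAdj X W).Adj (Sum.inl v) (Sum.inr H) ↔ v ∈ H := by
  simp [augAdj, augRel]

theorem augAdj_inr_inl : (augAdj X W).Adj (Sum.inr H) (Sum.inl v) ↔ v ∈ H := by
  simp [augAdj, augRel]

theorem not_augAdj_inr_inr : ¬ (augAdj X W).Adj (Sum.inr H) (Sum.inr K) := by
  simp [augAdj, augRel]

theorem augAdj_inl_inl : (augAdj X W).Adj (Sum.inl v) (Sum.inl w) ↔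
    v ≠ w ∧ (X.Adj v w ∨ ∃ c d : MaxClique X S, W.Adj c d ∧ v ∈ c.1 ∧ w ∈ d.1) := by
  simp only [augAdj, fromRel_adj, augRel, ne_eq, Sum.inl.injEq]
  refine and_congr_right fun _ => ⟨?_, Or.inl⟩
  rintro (h | h | ⟨c, d, hcd, hw, hv⟩)
  exacts [h, Or.inl h.symm, Or.inr ⟨d, c, hcd.symm, hv, hw⟩]

end Augmented

section FactorSystems

variable {V : Type u} {X : SimpleGraph V} {𝔉 : Set (Set V)} {F K L : Set V} {n i : ℕ} {v : V}

theorem link_anti (h : F ⊆ L) : link X L ⊆ link X F := fun _ hv w hw => hv w (h hw)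

theorem notMem_link (hv : v ∈ F) : v ∉ link X F := fun h => (h v hv).ne rfl

theorem not_subset_link (hF : F.Nonempty) (hFL : F ⊆ L) : ¬ L ⊆ link X F := fun h =>
  let ⟨_, hf⟩ := hF
  notMem_link hf (h (hFL hf))

theorem IsGraphFactorSystem.exists_strictAntiOn_le (h : IsGraphFactorSystem X 𝔉 n) :
    ∃ rk : Set V → ℕ, (∀ L ∈ 𝔉, rk L ≤ n) ∧ StrictAntiOn rk 𝔉 := by
  classical
  have hle : ∀ L : 𝔉, Order.coheight L ≤ n := fun L =>
    Order.coheight_le fun p _ => by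
      have := h.chain_lt (p.length + 1) (fun i => (p i).1) (fun i j hij => p.strictMono hij)
        fun i => (p i).2
      exact_mod_cast (by omega : p.length ≤ n)
  have hfin : ∀ L : 𝔉, Order.coheight L < ⊤ := fun L => (hle L).trans_lt (ENat.natCast_lt_top n)
  refine ⟨fun L => if hL : L ∈ 𝔉 then (Order.coheight (⟨L, hL⟩ : 𝔉)).toNat else 0, ?_, ?_⟩
  · intro L hL
    simp only [hL, dif_pos]
    exact ENat.toNat_le_of_le_natCast (hle _)
  · intro L hL H hH hLH
    simp only [hL, hH, dif_pos]
    have hlt := Order.coheight_strictAnti (show (⟨L, hL⟩ : 𝔉) < ⟨H, hH⟩ from hLH) (hfin _)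
    rwa [← ENat.natCast_lt_natCast, ENat.natCast_toNat (hfin _).ne,
      ENat.natCast_toNat (hfin _).ne]

theorem IsGraphFactorSystem.wellFoundedLT (h : IsGraphFactorSystem X 𝔉 n) : WellFoundedLT 𝔉 := by
  obtain ⟨rk, hle, hanti⟩ := h.exists_strictAntiOn_le
  refine ⟨Subrelation.wf (fun {K L} hKL => ?_) (measure fun L : 𝔉 => n - rk L).wf⟩
  have := hanti K.2 L.2 hKL
  have := hle K K.2
  exact (by omega : n - rk K < n - rk L)

theorem inl_mem_augVerts : Sum.inl v ∈ augVerts 𝔉 L ↔ v ∈ L := by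
  simp [augVerts]

theorem inr_mem_augVerts : Sum.inr K ∈ augVerts 𝔉 L ↔ K ∈ 𝔉 ∧ K ⊂ L := by
  simp [augVerts]

theorem inl_mem_complVerts : Sum.inl v ∈ complVerts X 𝔉 F ↔ v ∉ link X F := by
  simp [complVerts, augVerts, projPart]

theorem inr_mem_complVerts : Sum.inr K ∈ complVerts X 𝔉 F ↔
    (K ∈ 𝔉 ∧ K ⊂ Set.univ) ∧ ¬ K ⊆ link X F ∧ ¬ F ⊆ K := by
  change (_ ∈ _ ∧ ¬ _) ↔ _
  rw [inr_mem_augVerts, ← not_or]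
  refine and_congr_right fun h => not_congr ?_
  simp [projPart, h.1, h.2]

/-- The vertices of `CL` that do not belong to the part of `CL` carried by `F^⊥`, which consists of
the vertices of `F^⊥` and the projection vertices of the domains contained in `F^⊥`. -/
def trimVerts (X : SimpleGraph V) (𝔉 : Set (Set V)) (F L : Set V) : Set (AugVertex V) :=
  augVerts 𝔉 L \ (Sum.inl '' link X F ∪ Sum.inr '' {K | K ⊆ link X F})

theorem inl_mem_trimVerts : Sum.inl v ∈ trimVerts X 𝔉 F L ↔ v ∈ L ∧ v ∉ link X F := by
  simp [trimVerts, augVerts]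

theorem inr_mem_trimVerts :
    Sum.inr K ∈ trimVerts X 𝔉 F L ↔ (K ∈ 𝔉 ∧ K ⊂ L) ∧ ¬ K ⊆ link X F := by
  simp [trimVerts, augVerts]

theorem trimVerts_subset_augVerts : trimVerts X 𝔉 F L ⊆ augVerts 𝔉 L := Set.sdiff_subset

theorem IsGraphFactorSystem.ssubset_of_notMem_trimVerts (h : IsGraphFactorSystem X 𝔉 n)
    (hFL : F ⊆ L) {x : AugVertex V} (hx : x ∈ augVerts 𝔉 L) (hx' : x ∉ trimVerts X 𝔉 F L) :
    F ⊂ L := by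
  refine hFL.ssubset_of_ne ?_
  rintro rfl
  refine hx' ?_
  rcases x with v | K
  · have hv := inl_mem_augVerts.1 hx
    exact inl_mem_trimVerts.2 ⟨hv, notMem_link hv⟩
  · obtain ⟨hK, hKF⟩ := inr_mem_augVerts.1 hx
    obtain ⟨k, hk⟩ := h.nonempty K hK
    exact inr_mem_trimVerts.2 ⟨⟨hK, hKF⟩, fun hs => notMem_link (hKF.1 hk) (hs hk)⟩

/-- The vertices obtained from `trimVerts X 𝔉 F univ` by deleting the projection vertices of the
domains that contain `F` and have rank less than `i`. -/
def stageVerts (X : SimpleGraph V) (𝔉 : Set (Set V)) (F : Set V) (rk : Set V → ℕ) (i : ℕ) :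
    Set (AugVertex V) :=
  trimVerts X 𝔉 F Set.univ \ Sum.inr '' {K | F ⊆ K ∧ rk K < i}

/-- The projection vertices of the domains of rank `i` that contain `F`. -/
def levelVerts (𝔉 : Set (Set V)) (F : Set V) (rk : Set V → ℕ) (i : ℕ) : Set (AugVertex V) :=
  Sum.inr '' {K | K ∈ 𝔉 ∧ F ⊆ K ∧ K ⊂ Set.univ ∧ rk K = i}

variable {rk : Set V → ℕ}

theorem inl_mem_stageVerts : Sum.inl v ∈ stageVerts X 𝔉 F rk i ↔ v ∉ link X F := by
  simp [stageVerts, inl_mem_trimVerts]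

theorem inr_mem_stageVerts : Sum.inr K ∈ stageVerts X 𝔉 F rk i ↔
    ((K ∈ 𝔉 ∧ K ⊂ Set.univ) ∧ ¬ K ⊆ link X F) ∧ (F ⊆ K → i ≤ rk K) := by
  simp [stageVerts, inr_mem_trimVerts]

theorem inl_notMem_levelVerts : Sum.inl v ∉ levelVerts 𝔉 F rk i := by
  simp [levelVerts]

theorem stageVerts_zero : stageVerts X 𝔉 F rk 0 = trimVerts X 𝔉 F Set.univ := by
  simp [stageVerts]

theorem stageVerts_succ :
    stageVerts X 𝔉 F rk (i + 1) = stageVerts X 𝔉 F rk i \ levelVerts 𝔉 F rk i := by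
  ext (v | K)
  · simp [inl_mem_stageVerts, inl_notMem_levelVerts]
  · rw [Set.mem_sdiff, inr_mem_stageVerts, inr_mem_stageVerts]
    simp only [levelVerts, Set.mem_image, Set.mem_ofPred_eq, Sum.inr.injEq, exists_eq_right,
      Nat.succ_le_iff, lt_iff_le_and_ne, ne_comm (a := i)]
    tauto

theorem stageVerts_eq_complVerts (hle : ∀ L ∈ 𝔉, rk L < i) :
    stageVerts X 𝔉 F rk i = complVerts X 𝔉 F := by
  ext (v | K)
  · rw [inl_mem_stageVerts, inl_mem_complVerts]
  · rw [inr_mem_stageVerts, inr_mem_complVerts, and_assoc]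
    refine and_congr_right fun hK => and_congr_right fun _ => ?_
    have := hle K hK.1
    exact imp_congr_right fun _ => by simp [this]

theorem trimVerts_subset_stageVerts (hanti : StrictAntiOn rk 𝔉) (hL : L ∈ 𝔉) :
    trimVerts X 𝔉 F L ⊆ stageVerts X 𝔉 F rk (rk L + 1) := by
  rintro (v | K) hx
  · exact inl_mem_stageVerts.2 (inl_mem_trimVerts.1 hx).2
  · obtain ⟨⟨hK, hKL⟩, hKF⟩ := inr_mem_trimVerts.1 hx
    exact inr_mem_stageVerts.2 ⟨⟨⟨hK, hKL.trans_subset (Set.subset_univ L)⟩, hKF⟩,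
      fun _ => hanti hK hL hKL⟩

theorem stageVerts_diff_subset_complVerts (hanti : StrictAntiOn rk 𝔉) (hL : L ∈ 𝔉) (hFL : F ⊆ L) :
    stageVerts X 𝔉 F rk (rk L) \ {Sum.inr L} ⊆ complVerts X 𝔉 L := by
  rintro (v | K) ⟨hS, hne⟩
  · exact inl_mem_complVerts.2 fun h => inl_mem_stageVerts.1 hS (link_anti hFL h)
  · obtain ⟨⟨hK, hKF⟩, hht⟩ := inr_mem_stageVerts.1 hS
    refine inr_mem_complVerts.2 ⟨hK, fun hKL => hKF (hKL.trans (link_anti hFL)), fun hLK => ?_⟩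
    have hLK' : L ⊂ K := hLK.ssubset_of_ne (by rintro rfl; exact hne rfl)
    exact (hanti hL hK.1 hLK').not_ge (hht (hFL.trans hLK))

end FactorSystems

section Trimming

variable {V : Type u} {X : SimpleGraph V} {W : SimpleGraph (MaxClique X Set.univ)}
  {𝔉 : Set (Set V)} {F K L : Set V} {n : ℕ} {u v : V}

/-- The part `C_L L = CL` of the hierarchy condition: the edges of `CX` between vertices of a domain
`L` come from some `L`-graph. -/
def HasDomainGraphs (X : SimpleGraph V) (W : SimpleGraph (MaxClique X Set.univ))
    (𝔉 : Set (Set V)) : Prop :=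
  ∀ L ∈ 𝔉, ∃ WL : SimpleGraph (MaxClique X L), augGraph X WL 𝔉 L = augGraph X W 𝔉 L

theorem HierarchyCondition.hasDomainGraphs (h : HierarchyCondition X W 𝔉) :
    HasDomainGraphs X W 𝔉 := fun L hL =>
  let ⟨WF, hWF⟩ := h
  ⟨WF L, (hWF L hL L hL subset_rfl).1⟩

theorem HasDomainGraphs.exists_augAdj_iff (h : HasDomainGraphs X W 𝔉) (hL : L ∈ 𝔉) :
    ∃ WL : SimpleGraph (MaxClique X L), ∀ v ∈ L, ∀ w ∈ L,
      ((augAdj X WL).Adj (Sum.inl v) (Sum.inl w) ↔ (augAdj X W).Adj (Sum.inl v) (Sum.inl w)) := by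
  obtain ⟨WL, hWL⟩ := h L hL
  refine ⟨WL, fun v hv w hw => ?_⟩
  exact iff_of_eq (congrArg (fun G : SimpleGraph (augVerts 𝔉 L) =>
    G.Adj ⟨Sum.inl v, inl_mem_augVerts.2 hv⟩ ⟨Sum.inl w, inl_mem_augVerts.2 hw⟩) hWL)

namespace IsGraphFactorSystem

/-- The path runs through the projection vertex of the domain `lk(u) ∩ L`, which contains both `v`
and `F`. -/
theorem nearIn_of_adj_link (h : IsGraphFactorSystem X 𝔉 n) (hF : F ∈ 𝔉) (hL : L ∈ 𝔉)
    (hFL : F ⊂ L) (hu : u ∈ link X F) (huL : u ∈ L) (hv : v ∉ link X F) (hvL : v ∈ L)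
    (hvu : X.Adj v u) : NearIn (augAdj X W) (trimVerts X 𝔉 F L) 3 (Sum.inl v) (Sum.inr F) := by
  obtain ⟨f, hf⟩ := h.nonempty F hF
  have hFM : F ⊆ link X {u} ∩ L := fun w hw =>
    ⟨fun t ht => by rw [Set.mem_singleton_iff.1 ht]; exact (hu w hw).symm, hFL.1 hw⟩
  have hvM : v ∈ link X {u} ∩ L :=
    ⟨fun t ht => by rw [Set.mem_singleton_iff.1 ht]; exact hvu, hvL⟩
  have hM : link X {u} ∩ L ∈ 𝔉 :=
    h.inter_mem _ (h.link_mem u ⟨f, (hFM hf).1⟩) _ hL ⟨f, hFM hf⟩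
  have hML : link X {u} ∩ L ⊂ L := ⟨Set.inter_subset_right, fun hs =>
    notMem_link (Set.mem_singleton u) (hs huL).1⟩
  have hv' : Sum.inl v ∈ trimVerts X 𝔉 F L := inl_mem_trimVerts.2 ⟨hvL, hv⟩
  have hf' : Sum.inl f ∈ trimVerts X 𝔉 F L := inl_mem_trimVerts.2 ⟨hFL.1 hf, notMem_link hf⟩
  have hM' : Sum.inr (link X {u} ∩ L) ∈ trimVerts X 𝔉 F L :=
    inr_mem_trimVerts.2 ⟨⟨hM, hML⟩, not_subset_link ⟨f, hf⟩ hFM⟩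
  have hF' : Sum.inr F ∈ trimVerts X 𝔉 F L :=
    inr_mem_trimVerts.2 ⟨⟨hF, hFL⟩, not_subset_link ⟨f, hf⟩ subset_rfl⟩
  exact ((NearIn.of_adj (augAdj_inl_inr.2 hvM) hv' hM').trans
    (NearIn.of_adj (augAdj_inr_inl.2 (hFM hf)) hM' hf')).trans
    (NearIn.of_adj (augAdj_inl_inr.2 hf) hf' hF')

/-- A maximal clique of `L` that meets `F^⊥` is not contained in it, so an edge of the `L`-graph
into `F^⊥` can be redirected to a vertex outside `F^⊥`. -/
theorem nearIn_of_augAdj_link (h : IsGraphFactorSystem X 𝔉 n) (hdg : HasDomainGraphs X W 𝔉)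
    (hF : F ∈ 𝔉) (hL : L ∈ 𝔉) (hFL : F ⊂ L) (hu : u ∈ link X F) (huL : u ∈ L)
    (hv : v ∉ link X F) (hvL : v ∈ L) (hvu : (augAdj X W).Adj (Sum.inl v) (Sum.inl u)) :
    NearIn (augAdj X W) (trimVerts X 𝔉 F L) 4 (Sum.inl v) (Sum.inr F) := by
  obtain ⟨WL, hWL⟩ := hdg.exists_augAdj_iff hL
  obtain ⟨f, hf⟩ := h.nonempty F hF
  rcases (augAdj_inl_inl.1 ((hWL v hvL u huL).2 hvu)).2 with hX | ⟨c, d, hcd, hvc, hud⟩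
  · exact (h.nearIn_of_adj_link hF hL hFL hu huL hv hvL hX).le (by omega)
  have hd : ∃ y ∈ d.1, y ∉ link X F := by
    by_contra! hd
    have hins : insert f d.1 ⊆ L ∧ X.IsClique (insert f d.1) :=
      ⟨Set.insert_subset (hFL.1 hf) d.2.prop.1,
        d.2.prop.2.insert fun y hy _ => (hd y hy f hf).symm⟩
    exact notMem_link hf (hd f (d.2.le_of_ge hins (Set.subset_insert f d.1)
      (Set.mem_insert f d.1)))
  obtain ⟨y, hyd, hy⟩ := hd
  have hyL : y ∈ L := d.2.prop.1 hyd
  have hyu : X.Adj y u := d.2.prop.2 hyd hud (by rintro rfl; exact hy hu)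
  have hnear : NearIn (augAdj X W) (trimVerts X 𝔉 F L) 3 (Sum.inl y) (Sum.inr F) :=
    h.nearIn_of_adj_link hF hL hFL hu huL hy hyL hyu
  by_cases hvy : v = y
  · subst hvy
    exact hnear.le (by omega)
  · have hadj := (hWL v hvL y hyL).1 (augAdj_inl_inl.2 ⟨hvy, Or.inr ⟨c, d, hcd, hvc, hyd⟩⟩)
    exact ((NearIn.of_adj hadj (inl_mem_trimVerts.2 ⟨hvL, hv⟩) hnear.left_mem).trans hnear).le
      (by omega)

/-- In a minimal domain that meets both `F^⊥` and its complement, every projection vertex lies on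
one side, so a path crossing from one side to the other does so along an edge between vertices of
`X`. -/
theorem exists_augAdj_of_not_subset_link (h : IsGraphFactorSystem X 𝔉 n)
    (hconn : ∀ M ∈ 𝔉, (augGraph X W 𝔉 M).Connected) (hK : K ∈ 𝔉) (hKF : ¬ K ⊆ link X F)
    (huK : u ∈ K) (hu : u ∈ link X F) :
    ∃ v ∈ K, ∃ t ∈ K, v ∉ link X F ∧ t ∈ link X F ∧
      (augAdj X W).Adj (Sum.inl v) (Sum.inl t) := by
  have := h.wellFoundedLT
  obtain ⟨⟨M, hM⟩, hMK, ⟨hMF, t, htM, ht⟩, hmin⟩ := exists_minimal_le_of_wellFoundedLT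
    (fun M : 𝔉 => ¬ M.1 ⊆ link X F ∧ ∃ t ∈ M.1, t ∈ link X F) ⟨K, hK⟩ ⟨hKF, u, huK, hu⟩
  replace hMK : M ⊆ K := hMK
  obtain ⟨w, hwM, hw⟩ := Set.not_subset.1 hMF
  obtain ⟨m, p, -, hp⟩ := connIn_of_connected (hconn M hM) (Sum.inl w) (inl_mem_augVerts.2 hwM)
    (Sum.inl t) (inl_mem_augVerts.2 htM)
  obtain ⟨⟨⟨a, b⟩, hab⟩, hd, ha, hb⟩ := p.exists_boundary_dart (trimVerts X 𝔉 F M)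
    (inl_mem_trimVerts.2 ⟨hwM, hw⟩) fun h => (inl_mem_trimVerts.1 h).2 ht
  have hbM : b ∈ augVerts 𝔉 M := hp b (p.dart_snd_mem_support_of_mem_darts hd)
  change a ∈ _ at ha
  change b ∉ _ at hb
  rcases a with a | A <;> rcases b with b | B
  · rw [inl_mem_augVerts] at hbM
    rw [inl_mem_trimVerts] at ha hb
    exact ⟨a, hMK ha.1, b, hMK hbM, ha.2, by tauto, hab⟩
  · rw [inr_mem_augVerts] at hbM
    rw [inr_mem_trimVerts, not_and_not_right] at hb
    exact absurd (hb hbM (augAdj_inl_inr.1 hab)) (inl_mem_trimVerts.1 ha).2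
  · rw [inl_mem_augVerts] at hbM
    rw [inl_mem_trimVerts, not_and_not_right] at hb
    obtain ⟨⟨hA, hAM⟩, hAF⟩ := inr_mem_trimVerts.1 ha
    have hMA := hmin (y := ⟨A, hA⟩) ⟨hAF, b, augAdj_inr_inl.1 hab, hb hbM⟩ hAM.1
    exact absurd hMA hAM.2
  · exact absurd hab not_augAdj_inr_inr

theorem nearIn_inr_of_notMem_trimVerts (h : IsGraphFactorSystem X 𝔉 n) (hF : F ∈ 𝔉) (hFL : F ⊆ L)
    {x : AugVertex V} (hx : x ∈ augVerts 𝔉 L) (hx' : x ∉ trimVerts X 𝔉 F L) :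
    NearIn (augAdj X W) (augVerts 𝔉 L) 3 x (Sum.inr F) := by
  obtain ⟨f, hf⟩ := h.nonempty F hF
  have hF' : Sum.inr F ∈ augVerts 𝔉 L :=
    inr_mem_augVerts.2 ⟨hF, h.ssubset_of_notMem_trimVerts hFL hx hx'⟩
  have hf' : Sum.inl f ∈ augVerts 𝔉 L := inl_mem_augVerts.2 (hFL hf)
  have hlink : ∀ u ∈ L, u ∈ link X F →
      NearIn (augAdj X W) (augVerts 𝔉 L) 2 (Sum.inl u) (Sum.inr F) := fun u huL hu =>
    (NearIn.of_adj (augAdj_inl_inl.2 ⟨(hu f hf).ne, Or.inl (hu f hf)⟩) (inl_mem_augVerts.2 huL)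
      hf').trans (NearIn.of_adj (augAdj_inl_inr.2 hf) hf' hF')
  rcases x with u | K
  · rw [inl_mem_trimVerts, not_and_not_right] at hx'
    have huL := inl_mem_augVerts.1 hx
    exact (hlink u huL (hx' huL)).le (by omega)
  · rw [inr_mem_trimVerts, not_and_not_right] at hx'
    obtain ⟨hK, hKL⟩ := inr_mem_augVerts.1 hx
    obtain ⟨k, hk⟩ := h.nonempty K hK
    exact ((NearIn.of_adj (augAdj_inr_inl.2 hk) hx (inl_mem_augVerts.2 (hKL.1 hk))).trans
      (hlink k (hKL.1 hk) (hx' ⟨hK, hKL⟩ hk))).le (by omega)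

theorem nearIn_inr_of_adj_notMem_trimVerts (h : IsGraphFactorSystem X 𝔉 n)
    (hconn : ∀ M ∈ 𝔉, (augGraph X W 𝔉 M).Connected) (hdg : HasDomainGraphs X W 𝔉) (hF : F ∈ 𝔉)
    (hL : L ∈ 𝔉) (hFL : F ⊆ L) {x y : AugVertex V} (hx : x ∈ trimVerts X 𝔉 F L)
    (hy : y ∈ augVerts 𝔉 L) (hy' : y ∉ trimVerts X 𝔉 F L) (hxy : (augAdj X W).Adj x y) :
    NearIn (augAdj X W) (trimVerts X 𝔉 F L) 5 x (Sum.inr F) := by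
  replace hFL := h.ssubset_of_notMem_trimVerts hFL hy hy'
  rcases x with v | K <;> rcases y with u | M
  · rw [inl_mem_augVerts] at hy
    rw [inl_mem_trimVerts] at hx hy'
    exact (h.nearIn_of_augAdj_link hdg hF hL hFL (by tauto) hy hx.2 hx.1 hxy).le (by omega)
  · rw [inr_mem_trimVerts, not_and_not_right] at hy'
    exact absurd (hy' (inr_mem_augVerts.1 hy) (augAdj_inl_inr.1 hxy)) (inl_mem_trimVerts.1 hx).2
  · rw [inl_mem_trimVerts, not_and_not_right] at hy'
    obtain ⟨⟨hK, hKL⟩, hKF⟩ := inr_mem_trimVerts.1 hx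
    obtain ⟨v, hvK, t, htK, hv, ht, hvt⟩ := h.exists_augAdj_of_not_subset_link hconn hK hKF
      (augAdj_inr_inl.1 hxy) (hy' (inl_mem_augVerts.1 hy))
    have hn := h.nearIn_of_augAdj_link hdg hF hL hFL ht (hKL.1 htK) hv (hKL.1 hvK) hvt
    exact ((NearIn.of_adj (augAdj_inr_inl.2 hvK) hx hn.left_mem).trans hn).le (by omega)
  · exact absurd hxy not_augAdj_inr_inr

open Classical in
theorem isCoarseRetraction (h : IsGraphFactorSystem X 𝔉 n)
    (hconn : ∀ M ∈ 𝔉, (augGraph X W 𝔉 M).Connected) (hdg : HasDomainGraphs X W 𝔉) (hF : F ∈ 𝔉)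
    (hL : L ∈ 𝔉) (hFL : F ⊆ L) :
    IsCoarseRetraction (augAdj X W) (augVerts 𝔉 L) (trimVerts X 𝔉 F L)
      (fun x => if x ∈ trimVerts X 𝔉 F L then x else Sum.inr F) 5 where
  subset := trimVerts_subset_augVerts
  mapsTo x hx := by
    dsimp only
    split_ifs with hx'
    · exact hx'
    · exact inr_mem_trimVerts.2 ⟨⟨hF, h.ssubset_of_notMem_trimVerts hFL hx hx'⟩,
        not_subset_link (h.nonempty F hF) subset_rfl⟩
  fixed x hx := if_pos hx
  near x hx := by
    split_ifs with hx'
    · exact NearIn.refl hx _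
    · exact (h.nearIn_inr_of_notMem_trimVerts hF hFL hx hx').le (by omega)
  adj x hx y hy hxy := by
    split_ifs with hx' hy' hy'
    · exact (NearIn.of_adj hxy hx' hy').le (by omega)
    · exact h.nearIn_inr_of_adj_notMem_trimVerts hconn hdg hF hL hFL hx' hy hy' hxy
    · exact (h.nearIn_inr_of_adj_notMem_trimVerts hconn hdg hF hL hFL hy' hx hx' hxy.symm).symm
    · exact NearIn.refl (inr_mem_trimVerts.2 ⟨⟨hF, h.ssubset_of_notMem_trimVerts hFL hx hx'⟩,
        not_subset_link (h.nonempty F hF) subset_rfl⟩) _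

end IsGraphFactorSystem

theorem exists_isHyperbolicGraph_trimVerts (N : ℕ) :
    ∃ N' : ℕ, ∀ (V : Type u) (X : SimpleGraph V) (W : SimpleGraph (MaxClique X Set.univ))
      (𝔉 : Set (Set V)) (n : ℕ), IsGraphFactorSystem X 𝔉 n →
      (∀ L ∈ 𝔉, IsHyperbolicGraph N (augGraph X W 𝔉 L)) → HasDomainGraphs X W 𝔉 →
      ∀ F ∈ 𝔉, ∀ L ∈ 𝔉, F ⊆ L →
        IsHyperbolicGraph N' ((augAdj X W).induce (trimVerts X 𝔉 F L)) := by
  obtain ⟨N', hN'⟩ := exists_isHyperbolicGraph_of_isCoarseRetraction N 5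
  refine ⟨N', fun V X W 𝔉 n h hyp hdg F hF L hL hFL => ?_⟩
  obtain ⟨f, hf⟩ := h.nonempty F hF
  exact hN' _ _ _ _ _ ⟨Sum.inl f, inl_mem_trimVerts.2 ⟨hFL hf, notMem_link hf⟩⟩
    (slimIn_of_isHyperbolicGraph (hyp L hL))
    (h.isCoarseRetraction (fun M hM => (hyp M hM).1) hdg hF hL hFL)

end Trimming

section Stages

variable {V : Type u} {X : SimpleGraph V} {W : SimpleGraph (MaxClique X Set.univ)}
  {𝔉 : Set (Set V)} {F L : Set V} {rk : Set V → ℕ} {n i D N : ℕ} {δ : ℝ}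

theorem HyperbolicityCondition.nearIn_trimVerts (h : HyperbolicityCondition X W 𝔉 δ)
    (hfs : IsGraphFactorSystem X 𝔉 n) (hdg : HasDomainGraphs X W 𝔉) (hδ : 0 < δ) (hδD : δ ≤ D)
    (hδD' : δ * δ ≤ D) (hF : F ∈ 𝔉) (hL : L ∈ 𝔉) (hFL : F ⊆ L) {x y : AugVertex V}
    (hx : x ∈ trimVerts X 𝔉 F L) (hy : y ∈ trimVerts X 𝔉 F L) {m : ℕ}
    (hxy : NearIn (augAdj X W) (complVerts X 𝔉 L) m x y) :
    NearIn (augAdj X W) (trimVerts X 𝔉 F L) (5 * (D * m + D)) x y := by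
  obtain ⟨hyp, hsub, hqi⟩ := h L hL
  have hxy' := (connIn_of_connected hyp.1).nearIn_of_isQIEmbedding hδ hδD hδD' hsub hqi
    (trimVerts_subset_augVerts hx) (trimVerts_subset_augVerts hy) hxy
  exact (hfs.isCoarseRetraction (fun M hM => (h M hM).1.1) hdg hF hL hFL).nearIn hxy' hx hy

theorem HyperbolicityCondition.isConeFamily (h : HyperbolicityCondition X W 𝔉 δ)
    (hfs : IsGraphFactorSystem X 𝔉 n) (hdg : HasDomainGraphs X W 𝔉) (hδ : 0 < δ) (hδD : δ ≤ D)
    (hδD' : δ * δ ≤ D) (hDN : 5 * D ≤ N) (hF : F ∈ 𝔉) (hanti : StrictAntiOn rk 𝔉)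
    (hstage : SlimIn (augAdj X W) N (stageVerts X 𝔉 F rk i))
    (htrim : ∀ L ∈ 𝔉, F ⊆ L → SlimIn (augAdj X W) N (trimVerts X 𝔉 F L)) :
    IsConeFamily (augAdj X W) (stageVerts X 𝔉 F rk i) (levelVerts 𝔉 F rk i)
      (Sum.elim (fun _ => ∅) (trimVerts X 𝔉 F)) N where
  slim := hstage
  subset := by
    rintro _ ⟨L, ⟨hL, hFL, hLX, rfl⟩, rfl⟩
    exact inr_mem_stageVerts.2
      ⟨⟨⟨hL, hLX⟩, not_subset_link (hfs.nonempty F hF) hFL⟩, fun _ => le_rfl⟩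
  base_subset := by
    rintro _ ⟨L, ⟨hL, -, -, rfl⟩, rfl⟩
    rw [← stageVerts_succ]
    exact trimVerts_subset_stageVerts hanti hL
  adj_mem := by
    rintro _ ⟨L, -, rfl⟩ (v | K) hS hadj
    · exact inl_mem_trimVerts.2 ⟨augAdj_inl_inr.1 hadj, inl_mem_stageVerts.1 hS⟩
    · exact absurd hadj not_augAdj_inr_inr
  base_slim := by
    rintro _ ⟨L, ⟨hL, hFL, -, -⟩, rfl⟩
    exact htrim L hL hFL
  base_embed := by
    rintro _ ⟨L, ⟨hL, hFL, -, rfl⟩, rfl⟩ x hx y hy m hxy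
    refine (h.nearIn_trimVerts hfs hdg hδ hδD hδD' hF hL hFL hx hy
      (hxy.mono (stageVerts_diff_subset_complVerts hanti hL hFL))).le ?_
    nlinarith [Nat.mul_le_mul_right m hDN]

theorem exists_isHyperbolicGraph_stageVerts (hδ : 0 < δ) (i : ℕ) :
    ∃ N : ℕ, ∀ (V : Type u) (X : SimpleGraph V) (W : SimpleGraph (MaxClique X Set.univ))
      (𝔉 : Set (Set V)) (n : ℕ), IsGraphFactorSystem X 𝔉 n → HyperbolicityCondition X W 𝔉 δ →
      HasDomainGraphs X W 𝔉 → ∀ F ∈ 𝔉, ∀ rk : Set V → ℕ, StrictAntiOn rk 𝔉 →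
        IsHyperbolicGraph N ((augAdj X W).induce (stageVerts X 𝔉 F rk i)) := by
  obtain ⟨D, hD⟩ := exists_nat_ge (max δ (δ * δ))
  obtain ⟨hδD, hδD'⟩ := max_le_iff.1 hD
  obtain ⟨M, hM⟩ := exists_isHyperbolicGraph_trimVerts.{u} D
  have htrim : ∀ (V : Type u) (X : SimpleGraph V) (W : SimpleGraph (MaxClique X Set.univ))
      (𝔉 : Set (Set V)) (n : ℕ), IsGraphFactorSystem X 𝔉 n → HyperbolicityCondition X W 𝔉 δ →
      HasDomainGraphs X W 𝔉 → ∀ F ∈ 𝔉, ∀ L ∈ 𝔉, F ⊆ L →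
        IsHyperbolicGraph M ((augAdj X W).induce (trimVerts X 𝔉 F L)) :=
    fun V X W 𝔉 n hfs hyp => hM V X W 𝔉 n hfs fun L hL => isHyperbolicGraph_mono (hyp L hL).1 hδD
  induction i with
  | zero =>
    refine ⟨M, fun V X W 𝔉 n hfs hyp hdg F hF rk _ => ?_⟩
    rw [stageVerts_zero]
    exact htrim V X W 𝔉 n hfs hyp hdg F hF _ hfs.univ_mem (Set.subset_univ F)
  | succ i ih =>
    obtain ⟨N, hN⟩ := ih
    obtain ⟨N', hN'⟩ := exists_isHyperbolicGraph_of_isConeFamily (N + M + 5 * D)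
    refine ⟨N', fun V X W 𝔉 n hfs hyp hdg F hF rk hanti => ?_⟩
    obtain ⟨f, hf⟩ := hfs.nonempty F hF
    have hstage : SlimIn (augAdj X W) (N + M + 5 * D) (stageVerts X 𝔉 F rk i) :=
      slimIn_of_isHyperbolicGraph (isHyperbolicGraph_mono (hN V X W 𝔉 n hfs hyp hdg F hF rk hanti)
        (by exact_mod_cast (by omega : N ≤ N + M + 5 * D)))
    have hbase : ∀ L ∈ 𝔉, F ⊆ L → SlimIn (augAdj X W) (N + M + 5 * D) (trimVerts X 𝔉 F L) :=
      fun L hL hFL => slimIn_of_isHyperbolicGraph (isHyperbolicGraph_mono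
        (htrim V X W 𝔉 n hfs hyp hdg F hF L hL hFL)
        (by exact_mod_cast (by omega : M ≤ N + M + 5 * D)))
    rw [stageVerts_succ]
    exact hN' _ _ _ _ _ ⟨Sum.inl f, inl_mem_stageVerts.2 (notMem_link hf), inl_notMem_levelVerts⟩
      (hyp.isConeFamily hfs hdg hδ hδD hδD' (by omega) hF hanti hstage hbase)

end Stages

end CHHF

theorem lemma3p10_general (n : ℕ) (δ : ℝ) (hδ : 0 < δ) :
    ∃ δ' : ℝ, 0 < δ' ∧
      ∀ (V : Type u) (X : SimpleGraph V) (W : SimpleGraph (CHHF.MaxClique X Set.univ))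
        (𝔉 : Set (Set V)), CHHF.IsGraphFactorSystem X 𝔉 n → CHHF.HyperbolicityCondition X W 𝔉 δ →
          CHHF.HasDomainGraphs X W 𝔉 → ∀ F ∈ 𝔉, IsHyperbolicGraph δ' (CHHF.complGraph X W 𝔉 F) := by
  obtain ⟨N, hN⟩ := CHHF.exists_isHyperbolicGraph_stageVerts.{u} hδ (n + 1)
  refine ⟨N + 1, by positivity, fun V X W 𝔉 hfs hyp hdg F hF => ?_⟩
  obtain ⟨rk, hle, hanti⟩ := hfs.exists_strictAntiOn_le
  have hstage := hN V X W 𝔉 n hfs hyp hdg F hF rk hanti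
  rw [CHHF.stageVerts_eq_complVerts fun L hL => Nat.lt_succ_of_le (hle L hL)] at hstage
  exact HyperbolicGraph.isHyperbolicGraph_mono hstage (by linarith)

theorem lemma3p10 (n : ℕ) (δ : ℝ) (hδ : 0 < δ) :
    ∃ δ' : ℝ, 0 < δ' ∧
      ∀ (V : Type u) (X : SimpleGraph V) (W : SimpleGraph (CHHF.MaxClique X Set.univ))
        (𝔉 : Set (Set V)), CHHF.IsCHHF X W 𝔉 n δ →
          ∀ F ∈ 𝔉, IsHyperbolicGraph δ' (CHHF.complGraph X W 𝔉 F) := by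
  obtain ⟨δ', hδ', h⟩ := lemma3p10_general.{u} n δ hδ
  exact ⟨δ', hδ', fun V X W 𝔉 hX =>
    h V X W 𝔉 hX.factorSystem hX.hyperbolicity hX.hierarchy.hasDomainGraphs⟩
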